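/- **Setting.** Contexts $S\in\mathcal S$, actions $A\in\mathcal A$, rewards $R\in\mathbb R$; $P_S$ is a probability distribution on $\mathcal S$, $P_R(\cdot\mid s,a)$ a conditional reward distribution, and $\pi_b,\pi_e$ (behavior and target policy) are conditional densities $\pi(a\mid s)$ with respect to a fixed ($s$-finite) reference measure $\mathrm da$ on $\mathcal A$. Write $P^{\pi_e}$ for the law of $(S,R)$ when $S\sim P_S$, $A\sim\pi_e(\cdot\mid S)$, $R\sim P_R(\cdot\mid S,A)$. Let $w(s,a)=\pi_e(a\mid s)/\pi_b(a\mid s)$ with $0/0=0$, and assume $B=\inf\{b:\pi_e(a\mid s)\le b\,\pi_b(a\mid s)\ \forall (s,a)\}<\infty$. Let $\epsilon,\delta,\gamma\in(0,1)$ and $\epsilon_{\rm up}-\epsilon_{\rm lo}=1-\epsilon$. Let $\mathcal D=\{(S_i,A_i,R_i)\}_{i=1}^n$ be i.i.d. with $S_i\sim P_S$, $A_i\sim\pi_b(\cdot\mid S_i)$, $R_i\sim P_R(\cdot\mid S_i,A_i)$; let $V=(V_1,\dots,V_n)$ be i.i.d. uniform on $[0,1]$, independent of $\mathcal D$; and let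 $(S_{n+1},R_{n+1})\sim P^{\pi_e}$ be independent of $(\mathcal D,V)$. **Algorithm.** (Rejection sampling) Keep the pairs $(S_i,R_i)$ with $V_i\le w(S_i,A_i)/B$, in their original order; let $N$ be their number. (Split) By a fixed rule depending only on $N$, split the kept sample into a calibration set of size $M=\lceil\gamma N\rceil$ and a training set of size $N-M$. (Train) An arbitrary (measurable) algorithm without exogenous randomness computes from the training set real functions $\hat q_{\epsilon_{\rm lo}},\hat q_{\epsilon_{\rm up}}$ on $\mathcal S$. (Calibrate) For each calibration point put $\tau_i=\max\{\hat q_{\epsilon_{\rm lo}}(S_i)-R_i,\ R_i-\hat q_{\epsilon_{\rm up}}(S_i)\}$; let $\tau_{(1)}\le\dots\le\tau_{(M)}$ be the ordered scores and $\tau_{(M+1)}=\infty$. Let $k(M,\epsilon,\delta)$ be the largest $k\in\{-1,0,\dots,M-1\}$ with $F_{\mathrm{Bin}(M,\epsilon)}(k)\le\delta$, put $\tilde\tau=\tau_{(M-k(M,\epsilon,\delta))}$, and output $\hat C_{\tilde\tau}(s)=[\hat q_{\epsilon_{\rm lo}}(s)-\tilde\tau,\ \hat q_{\epsilon_{\rm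 up}}(s)+\tilde\tau]$ (which is $\mathbb R$ if $\tilde\tau=\infty$). Its miscoverage is the conditional probability $L_{P^{\pi_e}}(\hat C_{\tilde\tau})=\mathbb P[R_{n+1}\notin\hat C_{\tilde\tau}(S_{n+1})\mid\mathcal D,V]$. **Theorem 2.** Let $n\ge1$ and suppose that almost surely there are no ties among the calibration scores $\tau_i$. Then $$\mathbb P\big[L_{P^{\pi_e}}(\hat C_{\tilde\tau})\le\epsilon\big]<1-\delta+\frac{C}{\sqrt n},\qquad C=\frac{7B}{\sqrt{\gamma\epsilon(1-\epsilon)}}+\sqrt{\lfloor m_0/\gamma\rfloor B}+\frac B2,\quad m_0=\log_{1-\epsilon}\delta .$$ -/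

import Mathlib

open MeasureTheory ProbabilityTheory
open scoped NNReal ENNReal

namespace OffPolicy

noncomputable section

/-! ### Contextual bandit -/

/-- A stochastic policy on the action space `𝒜`, given by its conditional densities `π(a | s)` with
respect to the reference measure `ν` on `𝒜` (written `da` in integrals over actions). -/
structure Policy (𝒮 : Type*) {𝒜 : Type*} [MeasurableSpace 𝒮] [MeasurableSpace 𝒜]
    (ν : Measure 𝒜) where
  /-- `density s a` is `π(a | s)`. -/
  density : 𝒮 → 𝒜 → ℝ≥0
  measurable_density : Measurable (fun x : 𝒮 × 𝒜 => density x.1 x.2)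
  lintegral_density : ∀ s, ∫⁻ a, (density s a : ℝ≥0∞) ∂ν = 1

variable {𝒮 𝒜 : Type*} [MeasurableSpace 𝒮] [MeasurableSpace 𝒜] {ν : Measure 𝒜}

/-- The Markov kernel `s ↦ π(a | s) da` of a policy. -/
def Policy.kernel [SFinite ν] (π : Policy 𝒮 ν) : Kernel 𝒮 𝒜 :=
  (Kernel.const 𝒮 ν).withDensity (fun s a => (π.density s a : ℝ≥0∞))

instance Policy.isMarkovKernel_kernel [SFinite ν] (π : Policy 𝒮 ν) :
    IsMarkovKernel π.kernel := by
  refine ⟨fun s => ⟨?_⟩⟩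
  have hm : Measurable (Function.uncurry fun s a => (π.density s a : ℝ≥0∞)) :=
    measurable_coe_nnreal_ennreal.comp π.measurable_density
  rw [Policy.kernel, Kernel.withDensity_apply' _ hm, Kernel.const_apply,
    Measure.restrict_univ, π.lintegral_density]

/-- The law of one observation `((S, A), R)` when actions are drawn from the policy `π`:
`S ∼ P_S`, `A ∼ π(· | S)`, `R ∼ P_R(· | S, A)`. -/
def observationLaw [SFinite ν] (PS : Measure 𝒮) (PR : Kernel (𝒮 × 𝒜) ℝ) (π : Policy 𝒮 ν) :
    Measure ((𝒮 × 𝒜) × ℝ) :=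
  (PS ⊗ₘ π.kernel) ⊗ₘ PR

/-- The law `P^π` of the pair (context, reward) under the policy `π`. -/
def contextRewardLaw [SFinite ν] (PS : Measure 𝒮) (PR : Kernel (𝒮 × 𝒜) ℝ) (π : Policy 𝒮 ν) :
    Measure (𝒮 × ℝ) :=
  (observationLaw PS PR π).map (fun x => (x.1.1, x.2))

/-! ### Rejection sampling -/

/-- The constants `b` such that `π_e(a | s) ≤ b π_b(a | s)` for all `(s, a)`. -/
def dominatingConstants (πe πb : Policy 𝒮 ν) : Set ℝ :=
  {b | ∀ s a, (πe.density s a : ℝ) ≤ b * (πb.density s a : ℝ)}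

/-- `B`, the infimum of the dominating constants. -/
def boundB (πe πb : Policy 𝒮 ν) : ℝ := sInf (dominatingConstants πe πb)

/-- The weight `w(s, a) = π_e(a | s) / π_b(a | s)`, with `0 / 0 = 0`. -/
def weight (πe πb : Policy 𝒮 ν) (s : 𝒮) (a : 𝒜) : ℝ :=
  (πe.density s a : ℝ) / (πb.density s a : ℝ)

open Classical in
/-- The indices `i` accepted by rejection sampling, i.e. those with `V_i ≤ w(S_i, A_i) / B`. -/
def accepted (πe πb : Policy 𝒮 ν) {n : ℕ} (d : Fin n → (𝒮 × 𝒜) × ℝ) (v : Fin n → ℝ) :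
    Finset (Fin n) :=
  {i | v i ≤ (1 / boundB πe πb) * weight πe πb (d i).1.1 (d i).1.2}

/-- The subsequence of `z` with indices in `I`, listed in increasing order of the indices. -/
def subsample {X : Type*} {n : ℕ} (I : Finset (Fin n)) (z : Fin n → X) : Fin I.card → X :=
  fun j => z (I.orderEmbOfFin rfl j)

/-- The accepted sample `Z_1, …, Z_N` of pairs (context, reward), in the original order. -/
def rejectionSample (πe πb : Policy 𝒮 ν) {n : ℕ} (d : Fin n → (𝒮 × 𝒜) × ℝ) (v : Fin n → ℝ) :
    Fin (accepted πe πb d v).card → 𝒮 × ℝ :=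
  subsample (accepted πe πb d v) (fun i => ((d i).1.1, (d i).2))

/-! ### Splitting and training -/

/-- A rule that splits a sample of any size `N` into a calibration part of size `⌈γ N⌉` and a
training part consisting of all other points. -/
structure SplitRule (γ : ℝ) where
  /-- The positions of the calibration points in a sample of size `N`. -/
  calib : (N : ℕ) → Finset (Fin N)
  card_calib : ∀ N, (calib N).card = ⌈γ * (N : ℝ)⌉₊

/-- A quantile estimation algorithm without exogenous randomness: for each level `α` it turns a
training sample (of any size) into a real function on the context space, measurably.
No accuracy is required. -/
structure QuantileAlgorithm (𝒮 : Type*) [MeasurableSpace 𝒮] where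
  /-- `estimate α z s` is the estimated `α`-quantile of the reward at `s`, trained on `z`. -/
  estimate : ℝ → {L : ℕ} → (Fin L → 𝒮 × ℝ) → 𝒮 → ℝ
  measurable_estimate : ∀ (α : ℝ) (L : ℕ),
    Measurable (fun p : (Fin L → 𝒮 × ℝ) × 𝒮 => estimate α p.1 p.2)

/-! ### Calibration -/

/-- The cumulative distribution function of `Bin(M, ε)` at the integer `k`. -/
def binomialCDF (M : ℕ) (ε : ℝ) (k : ℤ) : ℝ :=
  ∑ i ∈ Finset.range (k + 1).toNat, (M.choose i : ℝ) * ε ^ i * (1 - ε) ^ (M - i)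

/-- `k(M, ε, δ)`, the largest `k ∈ {-1, …, M - 1}` with `F_{Bin(M, ε)}(k) ≤ δ`. -/
def kIndex (M : ℕ) (ε δ : ℝ) : ℤ :=
  sSup {k : ℤ | -1 ≤ k ∧ k ≤ (M : ℤ) - 1 ∧ binomialCDF M ε k ≤ δ}

/-- The `j`-th smallest (`j = 1, …, M`) of the numbers `τ_1, …, τ_M`; it is `∞` for `j = M + 1`. -/
def orderStat {M : ℕ} (τ : Fin M → ℝ) (j : ℕ) : EReal :=
  if h : j - 1 < M then ((τ (Tuple.sort τ ⟨j - 1, h⟩) : ℝ) : EReal) else ⊤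

/-- The threshold `τ_{(M - k(M, ε, δ))}`. -/
def threshold {M : ℕ} (τ : Fin M → ℝ) (ε δ : ℝ) : EReal :=
  orderStat τ ((M : ℤ) - kIndex M ε δ).toNat

/-- The non-conformity score of `(s, r)` for the quantile functions `qlo`, `qup`. -/
def score (qlo qup : 𝒮 → ℝ) (z : 𝒮 × ℝ) : ℝ := max (qlo z.1 - z.2) (z.2 - qup z.1)

/-- The prediction interval `[qlo(s) - τ, qup(s) + τ]`, for an extended real `τ`. -/
def interval (qlo qup : 𝒮 → ℝ) (τ : EReal) (s : 𝒮) : Set ℝ :=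
  {r | (qlo s : EReal) - τ ≤ (r : EReal) ∧ (r : EReal) ≤ (qup s : EReal) + τ}

/-! ### The algorithm -/

/-- The estimated quantile function of level `α`, trained on the training part of `z`. -/
def fittedQuantile {γ : ℝ} (split : SplitRule γ) (Aqu : QuantileAlgorithm 𝒮) (α : ℝ)
    {N : ℕ} (z : Fin N → 𝒮 × ℝ) : 𝒮 → ℝ :=
  Aqu.estimate α (subsample (split.calib N)ᶜ z)

/-- The scores `τ_i` of the calibration part of `z`. -/
def calibrationScores {γ : ℝ} (split : SplitRule γ) (Aqu : QuantileAlgorithm 𝒮) (εlo εup : ℝ)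
    {N : ℕ} (z : Fin N → 𝒮 × ℝ) : Fin (split.calib N).card → ℝ :=
  fun j => score (fittedQuantile split Aqu εlo z) (fittedQuantile split Aqu εup z)
    (subsample (split.calib N) z j)

/-- The calibrated prediction interval computed from the accepted sample `z`. -/
def calibratedInterval {γ : ℝ} (split : SplitRule γ) (Aqu : QuantileAlgorithm 𝒮)
    (εlo εup ε δ : ℝ) {N : ℕ} (z : Fin N → 𝒮 × ℝ) : 𝒮 → Set ℝ :=
  interval (fittedQuantile split Aqu εlo z) (fittedQuantile split Aqu εup z)
    (threshold (calibrationScores split Aqu εlo εup z) ε δ)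

/-- The output of the algorithm on the data `d` and the auxiliary uniform numbers `v`. -/
def predictionInterval (πe πb : Policy 𝒮 ν) {γ : ℝ} (split : SplitRule γ)
    (Aqu : QuantileAlgorithm 𝒮) (εlo εup ε δ : ℝ) {n : ℕ}
    (d : Fin n → (𝒮 × 𝒜) × ℝ) (v : Fin n → ℝ) : 𝒮 → Set ℝ :=
  calibratedInterval split Aqu εlo εup ε δ (rejectionSample πe πb d v)

/-- The constant of the upper bound. -/
def constC (B γ ε δ : ℝ) : ℝ :=
  7 * B / √(γ * ε * (1 - ε)) + √((⌊Real.logb (1 - ε) δ / γ⌋ : ℝ) * B) + B / 2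

end

end OffPolicy

open OffPolicy

/-! An observation is accepted with conditional probability `w / B`, so reweighting turns the
behavior law into the target law. Hence the accepted positions form a Bernoulli(1/B) pattern and,
given that pattern, the accepted pairs are i.i.d. from P^{π_e} (`measureReal_accepted_sample`). It
remains to bound the probability for a fixed size N and to average over N ~ Bin(n, 1/B).

For fixed N, freeze the training set. The M calibration scores are then i.i.d., and for M ≥ 2 the
absence of ties makes their law atomless, so some t has upper tail exactly ε. Miscoverage at most ε
forces fewer than M - k scores below t, that is, at least k + 1 scores in [t, ∞). Their number is
Bin(M, ε), which gives the bound 1 - F(k). Maximality of k gives F(k + 1) > δ, and a single binomial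
mass is at most 1/σ (by Fourier inversion). The bound is therefore 1 - δ + 1/√(Mε(1 - ε))
(`measureReal_exceedSet_le`).

For the average, M ≥ γN, an AM-GM estimate trades 1/√N for √n/(N + 1) + 1/√n, and E[1/(N + 1)] ≤
B/(n + 1). The constant this produces is well below C, whence the strict inequality
(`sum_sizeBound_lt`). -/

namespace OffPolicy

/-! ### Acceptance patterns in i.i.d. samples and binomial counts. -/

section Sampling

variable {X Y : Type*} [MeasurableSpace X] [MeasurableSpace Y]

lemma measurable_subsample {n : ℕ} (I : Finset (Fin n)) :
    Measurable (subsample I : (Fin n → X) → Fin I.card → X) :=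
  measurable_pi_lambda _ fun _ => measurable_pi_apply _

/-- Splitting an i.i.d. sample at a fixed set of positions yields two independent i.i.d. samples. -/
lemma measurePreserving_subsample (μ : Measure X) [SigmaFinite μ] {n : ℕ} (I : Finset (Fin n)) :
    MeasurePreserving (fun x : Fin n → X => (subsample I x, subsample Iᶜ x))
      (Measure.pi fun _ => μ)
      ((Measure.pi fun _ : Fin I.card => μ).prod (Measure.pi fun _ : Fin Iᶜ.card => μ)) := by
  have h1 := (measurePreserving_piCongrLeft (fun _ : Fin n => μ)
    (finSumEquivOfFinset (s := I) rfl rfl)).symm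
  have h2 := measurePreserving_sumPiEquivProdPi
    (fun _ : Fin I.card ⊕ Fin Iᶜ.card => μ)
  exact h2.comp h1

/-- Restriction to a box and coordinatewise images both preserve product measures, so each
coordinate contributes one factor p. -/
lemma restrict_map_pi {ρ : Measure X} [IsProbabilityMeasure ρ] {A : Set X}
    {f : X → Y} (hf : Measurable f) {μ : Measure Y} [IsProbabilityMeasure μ]
    {p : ℝ≥0} (h : (ρ.restrict A).map f = p • μ) (N : ℕ) {E : Set (Fin N → Y)}
    (hE : MeasurableSet E) :
    (Measure.pi fun _ : Fin N => ρ)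
        ((fun x i => f (x i)) ⁻¹' E ∩ Set.univ.pi fun _ => A)
      = (p : ℝ≥0∞) ^ N * (Measure.pi fun _ : Fin N => μ) E := by
  have hm : Measurable (fun (x : Fin N → X) i => f (x i)) := by fun_prop
  rw [← Measure.restrict_apply (hm hE), Measure.restrict_pi_pi, ← Measure.map_apply hm hE,
    Measure.pi_map_pi (fun _ => hf.aemeasurable)]
  have h2 : (Measure.pi fun _ : Fin N => (ρ.restrict A).map f)
      = ((p : ℝ≥0∞) ^ N) • (Measure.pi fun _ : Fin N => μ) := by
    simp_rw [h]
    refine Measure.pi_eq fun s _ => ?_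
    rw [Measure.smul_apply, Measure.pi_pi, smul_eq_mul]
    simp only [Measure.smul_apply, ENNReal.smul_def, smul_eq_mul, Finset.prod_mul_distrib,
      Finset.prod_const, Finset.card_univ, Fintype.card_fin]
  rw [h2, Measure.smul_apply, smul_eq_mul]

/-- The probability that the accepted positions are exactly `I` and that the images of the accepted
points lie in `E`. -/
lemma measure_pattern {ρ : Measure X} [IsProbabilityMeasure ρ] {A : Set X}
    {f : X → Y} (hf : Measurable f) {μ : Measure Y} [IsProbabilityMeasure μ]
    {p : ℝ≥0} (h : (ρ.restrict A).map f = p • μ) {n : ℕ} (I : Finset (Fin n))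
    {E : Set (Fin I.card → Y)} (hE : MeasurableSet E) (hA : MeasurableSet A) :
    (Measure.pi fun _ : Fin n => ρ)
        {x | (∀ i, i ∈ I ↔ x i ∈ A) ∧ subsample I (fun i => f (x i)) ∈ E}
      = (p : ℝ≥0∞) ^ I.card * (ρ Aᶜ) ^ (n - I.card) * (Measure.pi fun _ => μ) E := by
  have hset : {x : Fin n → X | (∀ i, i ∈ I ↔ x i ∈ A) ∧ subsample I (fun i => f (x i)) ∈ E}
      = (fun x : Fin n → X => (subsample I x, subsample Iᶜ x)) ⁻¹'
        (((fun x i => f (x i)) ⁻¹' E ∩ Set.univ.pi fun _ => A) ×ˢ (Set.univ.pi fun _ => Aᶜ)) := by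
    ext x
    have e1 : (∀ j, subsample I x j ∈ A) ↔ ∀ i ∈ I, x i ∈ A := by
      constructor
      · intro hx i hi
        have : i ∈ Set.range (I.orderEmbOfFin rfl) := by simpa using hi
        obtain ⟨j, rfl⟩ := this
        exact hx j
      · exact fun hx j => hx _ (I.orderEmbOfFin_mem rfl j)
    have e2 : (∀ j, subsample Iᶜ x j ∈ Aᶜ) ↔ ∀ i ∉ I, x i ∉ A := by
      constructor
      · intro hx i hi
        have : i ∈ Set.range (Iᶜ.orderEmbOfFin rfl) := by simpa using hi
        obtain ⟨j, rfl⟩ := this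
        exact hx j
      · exact fun hx j => hx _ (Finset.mem_compl.1 (Iᶜ.orderEmbOfFin_mem rfl j))
    have e3 : subsample I (fun i => f (x i)) = fun j => f (subsample I x j) := rfl
    simp only [Set.mem_ofPred_eq, Set.mem_preimage, Set.mem_prod, Set.mem_inter_iff, Set.mem_pi,
      Set.mem_univ, true_imp_iff, e1, e2, e3]
    constructor
    · rintro ⟨h1, h2⟩
      exact ⟨⟨h2, fun i hi => (h1 i).1 hi⟩, fun i hi hx => hi ((h1 i).2 hx)⟩
    · rintro ⟨⟨h2, h1⟩, h3⟩
      exact ⟨fun i => ⟨h1 i, fun hx => by_contra fun hi => h3 i hi hx⟩, h2⟩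
  have hm : Measurable (fun (x : Fin I.card → X) i => f (x i)) := by fun_prop
  rw [hset, (measurePreserving_subsample ρ I).measure_preimage, Measure.prod_prod,
    restrict_map_pi hf h _ hE, Measure.pi_pi]
  · simp [Finset.card_compl]
    ring
  · exact (((hm hE).inter (MeasurableSet.univ_pi fun _ => hA)).prod
      (MeasurableSet.univ_pi fun _ => hA.compl)).nullMeasurableSet

/-- Degenerate case of the hypothesis of `measure_pattern`, used there to get the law of the pattern
alone. -/
lemma restrict_map_const {ρ : Measure X} [IsProbabilityMeasure ρ] (A : Set X) :
    (ρ.restrict A).map (fun _ => ()) = (ρ A).toNNReal • Measure.dirac () := by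
  rw [Measure.map_const, Measure.restrict_apply_univ]
  ext s
  simp [ENNReal.smul_def, ENNReal.coe_toNNReal (measure_ne_top ρ A)]

lemma measurableSet_pattern {A : Set X} (hA : MeasurableSet A) {n : ℕ} (I : Finset (Fin n)) :
    MeasurableSet {x : Fin n → X | ∀ i, i ∈ I ↔ x i ∈ A} := by
  rw [Set.ofPred_forall]
  refine MeasurableSet.iInter fun i => ?_
  by_cases hi : i ∈ I
  · have h : MeasurableSet ((fun x : Fin n → X => x i) ⁻¹' A) := measurable_pi_apply i hA
    convert h using 1
    ext x
    simp [hi]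
  · have h : MeasurableSet ((fun x : Fin n → X => x i) ⁻¹' Aᶜ) := measurable_pi_apply i hA.compl
    convert h using 1
    ext x
    simp [hi]

open Classical in
/-- The number of points of an i.i.d. sample in a set of probability `ε` is binomial. -/
lemma measureReal_card_lt {ρ : Measure X} [IsProbabilityMeasure ρ] {A : Set X}
    (hA : MeasurableSet A) (M : ℕ) (k : ℤ) :
    (Measure.pi fun _ : Fin M => ρ).real
        {x | (Finset.univ.filter fun i => x i ∈ A).card < (k + 1).toNat}
      = binomialCDF M (ρ.real A) k := by
  set m := (k + 1).toNat
  have hset : {x : Fin M → X | (Finset.univ.filter fun i => x i ∈ A).card < m}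
      = ⋃ I ∈ (Finset.univ.powerset.filter fun I : Finset (Fin M) => I.card < m),
        {x : Fin M → X | ∀ i, i ∈ I ↔ x i ∈ A} := by
    ext x
    simp only [Set.mem_ofPred_eq, Set.mem_iUnion, Finset.mem_filter, Finset.mem_powerset]
    constructor
    · intro hx
      exact ⟨_, ⟨Finset.subset_univ _, hx⟩, fun i => by simp⟩
    · rintro ⟨I, ⟨-, hI⟩, hx⟩
      convert hI using 2
      ext i
      simp [hx i]
  rw [hset, measureReal_biUnion_finset]
  · have hval : ∀ I : Finset (Fin M), (Measure.pi fun _ : Fin M => ρ).real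
        {x : Fin M → X | ∀ i, i ∈ I ↔ x i ∈ A}
        = (ρ.real A) ^ I.card * (1 - ρ.real A) ^ (M - I.card) := by
      intro I
      have := measure_pattern (ρ := ρ) measurable_const (restrict_map_const A) I
        (E := Set.univ) MeasurableSet.univ hA
      simp only [Set.mem_univ, and_true, measure_univ, mul_one] at this
      rw [measureReal_def, this, ENNReal.toReal_mul, ENNReal.toReal_pow, ENNReal.toReal_pow,
        ENNReal.coe_toNNReal (measure_ne_top ρ A), ← measureReal_def, ← measureReal_def,
        probReal_compl_eq_one_sub hA]
    simp_rw [hval]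
    rw [Finset.sum_filter, Finset.sum_powerset_apply_card
      (fun c => if c < m then (ρ.real A) ^ c * (1 - ρ.real A) ^ (M - c) else 0)]
    rw [binomialCDF, Finset.card_univ, Fintype.card_fin]
    simp only [nsmul_eq_mul, mul_ite, mul_zero]
    rw [← Finset.sum_filter]
    have hsub : (Finset.range (M + 1)).filter (· < m) ⊆ Finset.range m := by
      intro i hi
      simpa using (Finset.mem_filter.1 hi).2
    rw [← Finset.sum_subset hsub]
    -- Indices beyond M may occur in the cdf sum; their binomial coefficients vanish.
    · exact Finset.sum_congr rfl fun i _ => by ring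
    · intro i hi hi'
      have : M < i := by
        simp only [Finset.mem_filter, Finset.mem_range, not_and, Finset.mem_range] at hi hi'
        by_contra hc
        exact hi' (by omega) hi
      simp [Nat.choose_eq_zero_of_lt this]
  · intro I _ J _ hIJ
    refine Set.disjoint_left.2 fun x hx hx' => hIJ ?_
    ext i
    rw [hx i, hx' i]
  · exact fun I _ => measurableSet_pattern hA I

end Sampling

/-! ### Size of binomial probabilities and the choice of k. -/

section BinomialBound

open Complex in
/-- Fourier inversion for the coefficients of `(q + p X) ^ M`. -/
lemma two_pi_mul_binomial_eq_integral (M j : ℕ) (p q : ℝ) :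
    (2 * Real.pi : ℂ) * ((M.choose j : ℝ) * p ^ j * q ^ (M - j) : ℝ)
      = ∫ t in (-Real.pi)..Real.pi,
          ((p : ℂ) * exp (t * I) + q) ^ M * exp (-(j * t * I)) := by
  have hint : ∀ m : ℤ, (∫ t in (-Real.pi)..Real.pi, exp ((m * I) * t))
      = if m = 0 then (2 * Real.pi : ℂ) else 0 := by
    intro m
    split_ifs with hm
    · simp [hm]; ring
    · rw [integral_exp_mul_complex (by simpa using hm)]
      have : exp (m * I * Real.pi) = exp (m * I * (-Real.pi : ℝ)) := by
        rw [Complex.exp_eq_exp_iff_exists_int]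
        exact ⟨m, by push_cast; ring⟩
      rw [this]; simp
  have hexp : ∀ t : ℝ, ((p : ℂ) * exp (t * I) + q) ^ M * exp (-(j * t * I))
      = ∑ i ∈ Finset.range (M + 1),
          ((M.choose i : ℂ) * p ^ i * q ^ (M - i)) * exp ((((i : ℤ) - j : ℤ) * I) * t) := by
    intro t
    rw [add_pow, Finset.sum_mul]
    refine Finset.sum_congr rfl fun i _ => ?_
    have : exp ((((i : ℤ) - j : ℤ) * I) * t) = exp (t * I) ^ i * exp (-(j * t * I)) := by
      rw [← exp_nat_mul, ← exp_add]
      congr 1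
      push_cast; ring
    rw [this, mul_pow]; ring
  simp_rw [hexp]
  rw [intervalIntegral.integral_finsetSum]
  · simp_rw [intervalIntegral.integral_const_mul, hint]
    by_cases hj : j ∈ Finset.range (M + 1)
    · rw [Finset.sum_eq_single j]
      · simp; ring
      · intro i _ hi
        rw [if_neg (by omega), mul_zero]
      · exact fun h => absurd hj h
    · rw [Finset.sum_eq_zero]
      · rw [Finset.mem_range, not_lt] at hj
        simp [Nat.choose_eq_zero_of_lt hj]
      · intro i hi
        rw [if_neg, mul_zero]
        rintro h
        exact hj (by rwa [show j = i by omega])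
  · exact fun i _ => Continuous.intervalIntegrable (by fun_prop) _ _

-- The squared modulus is 1 - 2pq(1 - cos t); combine cos t ≤ 1 - 2t²/π² on [-π, π] with 1 - x ≤
-- exp(-x). The Gaussian bound makes the inversion integral explicit.
open Complex in
lemma norm_charFun_bernoulli_le {p q : ℝ} (hp : 0 ≤ p) (hq : 0 ≤ q) (hpq : p + q = 1) {t : ℝ}
    (ht : |t| ≤ Real.pi) :
    ‖(p : ℂ) * exp (t * I) + q‖ ≤ Real.exp (-(2 * (p * q) / Real.pi ^ 2 * t ^ 2)) := by
  have h1 : ‖(p : ℂ) * exp (t * I) + q‖ ^ 2 = 1 - 2 * (p * q) * (1 - Real.cos t) := by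
    rw [← normSq_eq_norm_sq, normSq_apply]
    have hre : ((p : ℂ) * exp (t * I) + q).re = p * Real.cos t + q := by
      simp [exp_ofReal_mul_I_re]
    have him : ((p : ℂ) * exp (t * I) + q).im = p * Real.sin t := by
      simp [exp_ofReal_mul_I_im]
    rw [hre, him]
    have hs := Real.sin_sq_add_cos_sq t
    obtain rfl : q = 1 - p := by linarith
    linear_combination p ^ 2 * hs
  have h3 : Real.cos t ≤ 1 - 2 / Real.pi ^ 2 * t ^ 2 := Real.cos_le_one_sub_mul_cos_sq ht
  refine le_of_sq_le_sq ?_ (Real.exp_pos _).le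
  rw [h1, ← Real.exp_nat_mul]
  have h4 := Real.add_one_le_exp (((2 : ℕ) : ℝ) * -(2 * (p * q) / Real.pi ^ 2 * t ^ 2))
  refine le_trans ?_ h4
  have h5 : 0 ≤ p * q := mul_nonneg hp hq
  have h6 := mul_le_mul_of_nonneg_left h3 h5
  push_cast
  have : p * q * (1 - 2 / Real.pi ^ 2 * t ^ 2) = p * q - 2 * (p * q) / Real.pi ^ 2 * t ^ 2 := by
    ring
  linarith

/-- Binomial probabilities are at most `1 / σ`. -/
lemma binomial_le_one_div_sqrt {M : ℕ} (hM : 1 ≤ M) (j : ℕ) {p : ℝ} (hp : p ∈ Set.Ioo (0 : ℝ) 1) :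
    (M.choose j : ℝ) * p ^ j * (1 - p) ^ (M - j) ≤ 1 / √(M * p * (1 - p)) := by
  obtain ⟨hp0, hp1⟩ := hp
  have hq0 : 0 < 1 - p := by linarith
  have hM' : (0 : ℝ) < M := by exact_mod_cast hM
  have hpi := Real.pi_pos
  set b : ℝ := M * (2 * (p * (1 - p)) / Real.pi ^ 2) with hb
  have hb0 : 0 < b := by positivity
  have h1 := congrArg norm (two_pi_mul_binomial_eq_integral M j p (1 - p))
  have hnn : 0 ≤ (M.choose j : ℝ) * p ^ j * (1 - p) ^ (M - j) := by positivity
  rw [norm_mul, Complex.norm_real, Real.norm_of_nonneg hnn] at h1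
  have h2 : ‖(2 * Real.pi : ℂ)‖ = 2 * Real.pi := by
    simp [abs_of_pos hpi]
  rw [h2] at h1
  have hgi := integrable_exp_neg_mul_sq hb0
  have h3 : 2 * Real.pi * ((M.choose j : ℝ) * p ^ j * (1 - p) ^ (M - j))
      ≤ ∫ t in (-Real.pi)..Real.pi, Real.exp (-b * t ^ 2) := by
    rw [h1]
    refine intervalIntegral.norm_integral_le_of_norm_le (by linarith) ?_ hgi.intervalIntegrable
    refine Filter.Eventually.of_forall fun t ht => ?_
    have habs : |t| ≤ Real.pi := abs_le.2 ⟨ht.1.le, ht.2⟩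
    have hn : ‖Complex.exp (-(j * t * Complex.I))‖ = 1 := by
      rw [show (-(j * t * Complex.I) : ℂ) = ((-(j * t) : ℝ) : ℂ) * Complex.I by push_cast; ring]
      exact Complex.norm_exp_ofReal_mul_I _
    rw [norm_mul, hn, mul_one, norm_pow]
    have h4 := norm_charFun_bernoulli_le hp0.le hq0.le (by ring) habs
    refine (pow_le_pow_left₀ (norm_nonneg _) h4 M).trans_eq ?_
    rw [← Real.exp_nat_mul]
    congr 1
    rw [hb]; ring
  have h4 : ∫ t in (-Real.pi)..Real.pi, Real.exp (-b * t ^ 2) ≤ √(Real.pi / b) := by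
    rw [← integral_gaussian, intervalIntegral.integral_of_le (by linarith)]
    exact setIntegral_le_integral hgi (Filter.Eventually.of_forall fun t => (Real.exp_pos _).le)
  -- After cancelling M p (1 - p) this is π³/2 ≤ 4π², i.e. π ≤ 8.
  have h5 : √(Real.pi / b) ≤ 2 * Real.pi * (1 / √(M * p * (1 - p))) := by
    have hs : 0 < M * p * (1 - p) := by positivity
    rw [show Real.pi / b = (Real.pi ^ 2 * (Real.pi / 2)) / (M * p * (1 - p)) by
      rw [hb]; field_simp]
    rw [Real.sqrt_div (by positivity), mul_one_div]
    gcongr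
    rw [Real.sqrt_le_left (by positivity)]
    nlinarith [Real.pi_lt_four, sq_nonneg Real.pi, mul_pos hpi hpi]
  have := (h3.trans h4).trans h5
  exact le_of_mul_le_mul_left this (by positivity)

lemma kIndex_spec {M : ℕ} {ε δ : ℝ} (hδ : 0 ≤ δ) :
    -1 ≤ kIndex M ε δ ∧ kIndex M ε δ ≤ (M : ℤ) - 1 ∧ binomialCDF M ε (kIndex M ε δ) ≤ δ := by
  refine Int.csSup_mem (s := {k : ℤ | -1 ≤ k ∧ k ≤ (M : ℤ) - 1 ∧ binomialCDF M ε k ≤ δ})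
    -- The cdf at -1 is an empty sum, so -1 is always admissible and the supremum is attained.
    ⟨-1, le_rfl, by omega, by simpa [binomialCDF] using hδ⟩ ⟨(M : ℤ) - 1, fun k hk => hk.2.1⟩

lemma lt_binomialCDF_kIndex_add_one {M : ℕ} {ε δ : ℝ} (hδ : δ ∈ Set.Ioo (0 : ℝ) 1) :
    δ < binomialCDF M ε (kIndex M ε δ + 1) := by
  obtain ⟨h1, h2, -⟩ := kIndex_spec (M := M) (ε := ε) hδ.1.le
  by_contra! hle
  rcases lt_or_ge (kIndex M ε δ + 1) M with h | h
  · have : kIndex M ε δ + 1 ≤ kIndex M ε δ :=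
      le_csSup (s := {k : ℤ | -1 ≤ k ∧ k ≤ (M : ℤ) - 1 ∧ binomialCDF M ε k ≤ δ})
        ⟨(M : ℤ) - 1, fun k hk => hk.2.1⟩ ⟨by omega, by omega, hle⟩
    omega
  -- Here k = M - 1, so k + 1 is not a competitor; but the cdf at M is 1 > δ.
  · have hk : (kIndex M ε δ + 1 + 1).toNat = M + 1 := by omega
    have hsum : binomialCDF M ε (kIndex M ε δ + 1) = 1 := by
      have := add_pow ε (1 - ε) M
      rw [binomialCDF, hk]
      rw [add_sub_cancel, one_pow] at this
      refine Eq.trans (Finset.sum_congr rfl fun i _ => ?_) this.symm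
      ring
    linarith [hδ.2]

/-- The cdf exceeds δ at k + 1, and passing back to k costs one binomial mass, at most 1/σ. -/
lemma one_sub_binomialCDF_kIndex_le {M : ℕ} (hM : 1 ≤ M) {ε δ : ℝ} (hε : ε ∈ Set.Ioo (0 : ℝ) 1)
    (hδ : δ ∈ Set.Ioo (0 : ℝ) 1) :
    1 - binomialCDF M ε (kIndex M ε δ) ≤ 1 - δ + 1 / √(M * ε * (1 - ε)) := by
  have h := lt_binomialCDF_kIndex_add_one (M := M) (ε := ε) hδ
  have h1 := (kIndex_spec (M := M) (ε := ε) hδ.1.le).1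
  have h2 : binomialCDF M ε (kIndex M ε δ + 1) = binomialCDF M ε (kIndex M ε δ)
      + (M.choose (kIndex M ε δ + 1).toNat : ℝ) * ε ^ (kIndex M ε δ + 1).toNat
        * (1 - ε) ^ (M - (kIndex M ε δ + 1).toNat) := by
    rw [binomialCDF, show (kIndex M ε δ + 1 + 1).toNat = (kIndex M ε δ + 1).toNat + 1 by omega,
      Finset.sum_range_succ, binomialCDF]
  have h3 := binomial_le_one_div_sqrt hM (kIndex M ε δ + 1).toNat hε
  linarith

end BinomialBound

/-! ### Calibration with a fixed score function. -/

section Calibration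

/-- An atomless law on the line has a smallest upper `ε`-quantile. -/
lemma exists_upper_quantile (ρ : Measure ℝ) [IsProbabilityMeasure ρ] [NullSingletonClass ρ]
    {ε : ℝ} (hε : ε ∈ Set.Ioo (0 : ℝ) 1) :
    ∃ t, ρ.real (Set.Ici t) = ε ∧ ∀ u < t, ε < ρ.real (Set.Ioi u) := by
  have hcont : Continuous (cdf ρ) := by
    rw [continuous_iff_continuousAt]
    intro a
    rw [(monotone_cdf ρ).continuousAt_iff_leftLim_eq_rightLim, StieltjesFunction.rightLim_eq]
    have h := (cdf ρ).measure_singleton a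
    rw [measure_cdf, measure_singleton, eq_comm, ENNReal.ofReal_eq_zero] at h
    exact le_antisymm ((monotone_cdf ρ).leftLim_le le_rfl) (by linarith)
  obtain ⟨a, ha⟩ := ((tendsto_cdf_atBot ρ).eventually_lt_const
    (show (0 : ℝ) < 1 - ε by linarith [hε.2])).exists
  obtain ⟨b, hb⟩ := ((tendsto_cdf_atTop ρ).eventually_const_lt
    (show 1 - ε < (1 : ℝ) by linarith [hε.1])).exists
  have hne : {x | cdf ρ x = 1 - ε}.Nonempty :=
    mem_range_of_exists_le_of_exists_ge hcont ⟨a, ha.le⟩ ⟨b, hb.le⟩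
  have hbdd : BddBelow {x | cdf ρ x = 1 - ε} := by
    refine ⟨a, fun x hx => ?_⟩
    by_contra! hlt
    have := monotone_cdf ρ hlt.le
    rw [show cdf ρ x = 1 - ε from hx] at this
    linarith
  have hclosed : IsClosed {x | cdf ρ x = 1 - ε} := isClosed_eq hcont continuous_const
  have hmem : cdf ρ (sInf {x | cdf ρ x = 1 - ε}) = 1 - ε := hclosed.csInf_mem hne hbdd
  have hIoi : ∀ x, ρ.real (Set.Ioi x) = 1 - cdf ρ x := by
    intro x
    rw [cdf_eq_real, ← Set.compl_Iic, probReal_compl_eq_one_sub measurableSet_Iic]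
  -- The infimum gives strictness below t even if the cdf is flat at height 1 - ε.
  refine ⟨sInf {x | cdf ρ x = 1 - ε}, ?_, fun u hu => ?_⟩
  · rw [measureReal_congr Ioi_ae_eq_Ici.symm, hIoi, hmem]
    ring
  · rw [hIoi]
    have h1 := monotone_cdf ρ hu.le
    rw [hmem] at h1
    have h2 : cdf ρ u ≠ 1 - ε := fun h => notMem_of_lt_csInf hu hbdd h
    have := lt_of_le_of_ne h1 h2
    linarith

variable {X : Type*} [MeasurableSpace X]

/-- All M scores hit an atom of mass m simultaneously with probability m^M, and this is a tie as
soon as M ≥ 2. -/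
lemma nullSingletonClass_of_ae_injective {μ : Measure X} [IsProbabilityMeasure μ] {sc : X → ℝ}
    (hsc : Measurable sc) {M : ℕ} (hM : 2 ≤ M)
    (h : ∀ᵐ y ∂(Measure.pi fun _ : Fin M => μ), Function.Injective fun i => sc (y i)) :
    NullSingletonClass (μ.map sc) := by
  refine ⟨fun a => ?_⟩
  rw [Measure.map_apply hsc (measurableSet_singleton a)]
  have h0 : (Measure.pi fun _ : Fin M => μ) (Set.univ.pi fun _ => sc ⁻¹' {a}) = 0 := by
    refine measure_mono_null (fun y hy => ?_) h
    intro hinj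
    have := @hinj ⟨0, by omega⟩ ⟨1, by omega⟩
      ((hy ⟨0, by omega⟩ trivial).trans (hy ⟨1, by omega⟩ trivial).symm)
    simp at this
  rw [Measure.pi_pi, Finset.prod_const] at h0
  exact eq_zero_of_pow_eq_zero h0

lemma measurable_card_filter {ι : Type*} [Fintype ι] {p : X → ι → Prop}
    [∀ x, DecidablePred (p x)] (hp : ∀ i, MeasurableSet {x | p x i}) :
    Measurable fun x => (Finset.univ.filter (p x)).card := by
  classical
  simp_rw [Finset.card_filter]
  refine Finset.measurable_sum _ fun i _ => ?_
  convert Measurable.ite (hp i) (measurable_const (a := 1)) (measurable_const (a := 0)) using 2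

/-- The points whose score exceeds at least `j` of the scores of `y`. -/
def exceedSet (sc : X → ℝ) {M : ℕ} (y : Fin M → X) (j : ℕ) : Set X :=
  {t | j ≤ (Finset.univ.filter fun i => sc (y i) < sc t).card}

/-- If the `j`-th smallest score of `y` has upper tail at most `ε`, then fewer than `j` scores lie
below the upper `ε`-quantile. -/
lemma card_lt_of_exceedSet_le {μ : Measure X} [IsProbabilityMeasure μ] {sc : X → ℝ}
    (hsc : Measurable sc) {M : ℕ} {y : Fin M → X} {j : ℕ} (hj : 1 ≤ j) {ε t : ℝ}
    (ht : ∀ u < t, ε < (μ.map sc).real (Set.Ioi u)) (h : μ.real (exceedSet sc y j) ≤ ε) :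
    (Finset.univ.filter fun i => sc (y i) < t).card < j := by
  by_contra! hge
  set I := Finset.univ.filter fun i => sc (y i) < t
  have hne : I.Nonempty := Finset.card_pos.1 (by omega)
  -- Take the largest score below t: any score above it exceeds at least j sample scores, yet the
  -- tail above it has mass greater than ε.
  obtain ⟨i₀, hi₀, hmax⟩ := I.exists_max_image (fun i => sc (y i)) hne
  have hsub : sc ⁻¹' (Set.Ioi (sc (y i₀))) ⊆ exceedSet sc y j := by
    intro x hx
    refine hge.trans (Finset.card_le_card fun i hi => ?_)
    simp only [Finset.mem_filter, Finset.mem_univ, true_and]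
    exact (hmax i hi).trans_lt hx
  have h1 := ht (sc (y i₀)) (by simpa [I] using hi₀)
  rw [map_measureReal_apply hsc measurableSet_Ioi] at h1
  linarith [measureReal_mono (μ := μ) hsub]

/-- Split conformal calibration on an i.i.d. sample without ties. -/
lemma measureReal_exceedSet_le {μ : Measure X} [IsProbabilityMeasure μ] {sc : X → ℝ}
    (hsc : Measurable sc) {M : ℕ} (hM : 1 ≤ M) {ε δ : ℝ} (hε : ε ∈ Set.Ioo (0 : ℝ) 1)
    (hδ : δ ∈ Set.Ioo (0 : ℝ) 1)
    (h : ∀ᵐ y ∂(Measure.pi fun _ : Fin M => μ), Function.Injective fun i => sc (y i)) :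
    (Measure.pi fun _ : Fin M => μ).real
        {y | μ.real (exceedSet sc y ((M : ℤ) - kIndex M ε δ).toNat) ≤ ε}
      ≤ 1 - δ + 1 / √(M * ε * (1 - ε)) := by
  have hq : 0 < 1 - ε := by linarith [hε.2]
  -- A single score never ties, so its law may have atoms; but for M = 1 the claimed bound is at
  -- least 1.
  rcases Nat.lt_or_ge M 2 with hM2 | hM2
  · obtain rfl : M = 1 := by omega
    refine measureReal_le_one.trans ?_
    have h1 : √((1 : ℕ) * ε * (1 - ε)) ≤ 1 := by
      refine (Real.sqrt_le_sqrt ?_).trans_eq Real.sqrt_one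
      push_cast
      nlinarith [hε.1, hε.2]
    have h2 : 0 < √((1 : ℕ) * ε * (1 - ε)) := by
      have := hε.1
      positivity
    have h3 : 1 ≤ 1 / √((1 : ℕ) * ε * (1 - ε)) := by rwa [le_div_iff₀ h2, one_mul]
    linarith [hδ.2]
  obtain ⟨hk1, hk2, hk3⟩ := kIndex_spec (M := M) (ε := ε) hδ.1.le
  have := nullSingletonClass_of_ae_injective hsc hM2 h
  have : IsProbabilityMeasure (μ.map sc) := Measure.isProbabilityMeasure_map hsc.aemeasurable
  obtain ⟨t, ht1, ht2⟩ := exists_upper_quantile (μ.map sc) hε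
  rw [map_measureReal_apply hsc measurableSet_Ici] at ht1
  have hA : MeasurableSet (sc ⁻¹' Set.Ici t) := hsc measurableSet_Ici
  classical
  refine le_trans ?_ (one_sub_binomialCDF_kIndex_le hM hε hδ)
  have hcard := measureReal_card_lt (ρ := μ) hA M (kIndex M ε δ)
  rw [ht1] at hcard
  have hmeas : MeasurableSet {x : Fin M → X |
      (Finset.univ.filter fun i => x i ∈ sc ⁻¹' Set.Ici t).card < (kIndex M ε δ + 1).toNat} := by
    refine measurable_card_filter (fun i => ?_) (measurableSet_Iio (a := (kIndex M ε δ + 1).toNat))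
    exact measurable_pi_apply (X := fun _ : Fin M => X) i hA
  rw [← hcard, ← probReal_compl_eq_one_sub hmeas]
  refine measureReal_mono fun y hy => ?_
  -- Fewer than M - k of the M scores lie below t, hence at least k + 1 are ≥ t.
  have h1 := card_lt_of_exceedSet_le hsc (by omega) ht2 hy
  have h2 := Finset.card_filter_add_card_filter_not (s := (Finset.univ : Finset (Fin M)))
    (fun i => sc (y i) < t)
  simp only [not_lt, Finset.card_univ, Fintype.card_fin] at h2
  simp only [Set.mem_compl_iff, Set.mem_ofPred_eq, not_lt, Set.mem_preimage, Set.mem_Ici]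
  omega

end Calibration

/-! ### From the prediction interval to counts of scores; samples of fixed size. -/

section Conformal

/-- Since the sorted scores increase, the scores below x fill an initial segment of positions.
Counting replaces sorting from here on, which makes measurability easy. The condition j ≥ 1 matters
because positions start at 0: truncated subtraction would read j = 0 as j = 1. -/
lemma orderStat_lt_coe_iff {M : ℕ} (τ : Fin M → ℝ) {j : ℕ} (hj : 1 ≤ j) (x : ℝ) :
    orderStat τ j < (x : EReal) ↔ j ≤ (Finset.univ.filter fun i => τ i < x).card := by
  unfold orderStat
  split_ifs with h
  · rw [EReal.coe_lt_coe_iff]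
    have hmono := Tuple.monotone_sort τ
    constructor
    · intro hx
      have hsub : (Finset.Iic (⟨j - 1, h⟩ : Fin M)).map (Tuple.sort τ).toEmbedding
          ⊆ Finset.univ.filter fun i => τ i < x := by
        intro i hi
        obtain ⟨l, hl, rfl⟩ := Finset.mem_map.1 hi
        simpa using (hmono (Finset.mem_Iic.1 hl)).trans_lt hx
      have := Finset.card_le_card hsub
      rw [Finset.card_map, Fin.card_Iic] at this
      simp only at this
      omega
    · intro hc
      by_contra! hx
      have hsub : (Finset.univ.filter fun i => τ i < x)
          ⊆ (Finset.Iio (⟨j - 1, h⟩ : Fin M)).map (Tuple.sort τ).toEmbedding := by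
        intro i hi
        refine Finset.mem_map.2 ⟨(Tuple.sort τ).symm i, ?_, by simp⟩
        rw [Finset.mem_Iio]
        by_contra! hle
        have h1 := hmono hle
        simp only [Function.comp_apply, Equiv.apply_symm_apply] at h1
        exact absurd (Finset.mem_filter.1 hi).2 (not_lt.2 (hx.trans h1))
      have := Finset.card_le_card hsub
      rw [Finset.card_map, Fin.card_Iio] at this
      simp only at this
      omega
  · have : (Finset.univ.filter fun i => τ i < x).card ≤ M := by
      simpa using Finset.card_filter_le (Finset.univ : Finset (Fin M)) (fun i => τ i < x)
    simp only [not_top_lt, false_iff, not_le]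
    omega

variable {𝒮 : Type*}

lemma notMem_interval_iff (qlo qup : 𝒮 → ℝ) {τ : EReal} (hτ : τ ≠ ⊥) (s : 𝒮) (r : ℝ) :
    r ∉ interval qlo qup τ s ↔ τ < (score qlo qup (s, r) : EReal) := by
  induction τ with
  | bot => exact absurd rfl hτ
  | top => simp [interval]
  | coe c =>
    simp only [interval, score, Set.mem_ofPred_eq, ← EReal.coe_sub, ← EReal.coe_add,
      EReal.coe_le_coe_iff, EReal.coe_lt_coe_iff, not_and_or, not_le, lt_max_iff]
    constructor
    · rintro (h | h)
      · left; linarith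
      · right; linarith
    · rintro (h | h)
      · left; linarith
      · right; linarith

lemma notMem_interval_threshold_iff (qlo qup : 𝒮 → ℝ) {M : ℕ} (τ : Fin M → ℝ) {ε δ : ℝ}
    (hδ : 0 ≤ δ) (s : 𝒮) (r : ℝ) :
    r ∉ interval qlo qup (threshold τ ε δ) s ↔
      ((M : ℤ) - kIndex M ε δ).toNat
        ≤ (Finset.univ.filter fun i => τ i < score qlo qup (s, r)).card := by
  have hk := (kIndex_spec (M := M) (ε := ε) hδ).2.1
  rw [notMem_interval_iff, threshold, orderStat_lt_coe_iff _ (by omega)]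
  unfold threshold orderStat
  split_ifs <;> simp

variable [MeasurableSpace 𝒮] {γ : ℝ} (split : SplitRule γ) (Aqu : QuantileAlgorithm 𝒮)
  (εlo εup ε δ : ℝ)

/-- The pairs (context, reward) missed by the interval computed from `y`. -/
def missSet {N : ℕ} (y : Fin N → 𝒮 × ℝ) : Set (𝒮 × ℝ) :=
  {t | t.2 ∉ calibratedInterval split Aqu εlo εup ε δ y t.1}

/-- The score computed from a training sample. -/
def trainedScore {L : ℕ} (z : Fin L → 𝒮 × ℝ) : 𝒮 × ℝ → ℝ :=
  score (Aqu.estimate εlo z) (Aqu.estimate εup z)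

-- Separates the two roles of the sample: the training part enters only through the score function,
-- the calibration part only through counts.
variable {δ} in
lemma missSet_eq_exceedSet (hδ : 0 ≤ δ) {N : ℕ} (y : Fin N → 𝒮 × ℝ) :
    missSet split Aqu εlo εup ε δ y
      = exceedSet (trainedScore Aqu εlo εup (subsample (split.calib N)ᶜ y))
        (subsample (split.calib N) y)
        (((split.calib N).card : ℤ) - kIndex (split.calib N).card ε δ).toNat := by
  ext ⟨s, r⟩
  exact notMem_interval_threshold_iff _ _ _ hδ s r

lemma measurable_trainedScore (L : ℕ) :
    Measurable fun p : (Fin L → 𝒮 × ℝ) × (𝒮 × ℝ) => trainedScore Aqu εlo εup p.1 p.2 := by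
  have h (α : ℝ) : Measurable fun p : (Fin L → 𝒮 × ℝ) × (𝒮 × ℝ) => Aqu.estimate α p.1 p.2.1 :=
    (Aqu.measurable_estimate α L).comp (by fun_prop : Measurable
      fun p : (Fin L → 𝒮 × ℝ) × (𝒮 × ℝ) => (p.1, p.2.1))
  unfold trainedScore score
  exact ((h εlo).sub (by fun_prop)).max ((by fun_prop : Measurable
    fun p : (Fin L → 𝒮 × ℝ) × (𝒮 × ℝ) => p.2.2).sub (h εup))

lemma measurableSet_exceedSet (L M j : ℕ) :
    MeasurableSet {p : ((Fin M → 𝒮 × ℝ) × (Fin L → 𝒮 × ℝ)) × (𝒮 × ℝ) |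
      p.2 ∈ exceedSet (trainedScore Aqu εlo εup p.1.2) p.1.1 j} := by
  have h := measurable_trainedScore Aqu εlo εup L
  refine measurable_card_filter (fun i => ?_) (measurableSet_Ici (a := j))
  refine measurableSet_lt ?_ ?_
  · exact h.comp (by fun_prop : Measurable fun p : ((Fin M → 𝒮 × ℝ) × (Fin L → 𝒮 × ℝ)) × (𝒮 × ℝ) =>
      (p.1.2, p.1.1 i))
  · exact h.comp (by fun_prop : Measurable fun p : ((Fin M → 𝒮 × ℝ) × (Fin L → 𝒮 × ℝ)) × (𝒮 × ℝ) =>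
      (p.1.2, p.2))

variable {δ}

lemma measurableSet_missSet (hδ : 0 ≤ δ) (N : ℕ) :
    MeasurableSet {p : (Fin N → 𝒮 × ℝ) × (𝒮 × ℝ) |
      p.2 ∈ missSet split Aqu εlo εup ε δ p.1} := by
  simp_rw [missSet_eq_exceedSet split Aqu εlo εup ε hδ]
  exact (((measurable_subsample (split.calib N)).comp measurable_fst).prodMk
    ((measurable_subsample (split.calib N)ᶜ).comp measurable_fst)).prodMk measurable_snd
      (measurableSet_exceedSet Aqu εlo εup _ _ _)

lemma measurableSet_exceedSet_le (μ : Measure (𝒮 × ℝ)) [IsProbabilityMeasure μ] (L M j : ℕ) :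
    MeasurableSet {p : (Fin M → 𝒮 × ℝ) × (Fin L → 𝒮 × ℝ) |
      μ.real (exceedSet (trainedScore Aqu εlo εup p.2) p.1 j) ≤ ε} :=
  measurableSet_le (measurable_measure_prodMk_left
    (measurableSet_exceedSet Aqu εlo εup L M j)).ennreal_toReal measurable_const

/-- The upper bound for a sample of fixed size from the target distribution. -/
lemma measureReal_missSet_le {μ : Measure (𝒮 × ℝ)} [IsProbabilityMeasure μ] {ε : ℝ}
    (hε : ε ∈ Set.Ioo (0 : ℝ) 1) (hδ : δ ∈ Set.Ioo (0 : ℝ) 1) {N : ℕ}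
    (hM : 1 ≤ ⌈γ * (N : ℝ)⌉₊)
    (h : ∀ᵐ y ∂(Measure.pi fun _ : Fin N => μ),
      Function.Injective (calibrationScores split Aqu εlo εup y)) :
    (Measure.pi fun _ : Fin N => μ).real {y | μ.real (missSet split Aqu εlo εup ε δ y) ≤ ε}
      ≤ 1 - δ + 1 / √(⌈γ * (N : ℝ)⌉₊ * ε * (1 - ε)) := by
  rw [← split.card_calib N] at hM ⊢
  set J := split.calib N
  set j := ((J.card : ℤ) - kIndex J.card ε δ).toNat
  have hmp := measurePreserving_subsample μ J
  have hinj : ∀ᵐ p ∂((Measure.pi fun _ : Fin J.card => μ).prod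
      (Measure.pi fun _ : Fin Jᶜ.card => μ)),
      Function.Injective fun i => trainedScore Aqu εlo εup p.2 (p.1 i) := by
    rw [← hmp.map_eq, ae_map_iff hmp.measurable.aemeasurable]
    · exact h
    · simp_rw [Function.Injective, Set.ofPred_forall]
      refine MeasurableSet.iInter fun a => MeasurableSet.iInter fun b => ?_
      have hm := measurable_trainedScore Aqu εlo εup Jᶜ.card
      have hm' (i : Fin J.card) : Measurable fun p : (Fin J.card → 𝒮 × ℝ) × (Fin Jᶜ.card → 𝒮 × ℝ) =>
          trainedScore Aqu εlo εup p.2 (p.1 i) :=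
        hm.comp (by fun_prop : Measurable fun p : (Fin J.card → 𝒮 × ℝ) × (Fin Jᶜ.card → 𝒮 × ℝ) =>
          (p.2, p.1 i))
      by_cases hab : a = b
      · simp [hab]
      · simp only [hab, imp_false]
        exact (measurableSet_eq_fun (hm' a) (hm' b)).compl
  -- The swap puts the training sample outside: for almost every fixed one, the calibration scores
  -- have no ties.
  have hinj2 := Measure.ae_ae_of_ae_prod
    ((Measure.measurePreserving_swap (μ := Measure.pi fun _ : Fin Jᶜ.card => μ)
      (ν := Measure.pi fun _ : Fin J.card => μ)).quasiMeasurePreserving.ae hinj)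
  set G := {p : (Fin J.card → 𝒮 × ℝ) × (Fin Jᶜ.card → 𝒮 × ℝ) |
      μ.real (exceedSet (trainedScore Aqu εlo εup p.2) p.1 j) ≤ ε}
  have hG : MeasurableSet G := measurableSet_exceedSet_le Aqu εlo εup ε μ _ _ j
  have hset : {y | μ.real (missSet split Aqu εlo εup ε δ y) ≤ ε}
      = (fun y => (subsample J y, subsample Jᶜ y)) ⁻¹' G := by
    ext y
    simp only [missSet_eq_exceedSet split Aqu εlo εup ε hδ.1.le]
    rfl
  have hnn : 0 ≤ 1 - δ + 1 / √(J.card * ε * (1 - ε)) := by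
    have := hδ.2
    have : 0 ≤ 1 / √(J.card * ε * (1 - ε)) := by positivity
    linarith
  rw [hset, measureReal_def, hmp.measure_preimage hG.nullMeasurableSet,
    Measure.prod_apply_symm hG]
  refine ENNReal.toReal_le_of_le_ofReal hnn ?_
  refine (lintegral_mono_ae (g := fun _ => ENNReal.ofReal
    (1 - δ + 1 / √(J.card * ε * (1 - ε)))) ?_).trans_eq (by simp)
  filter_upwards [hinj2] with z hz
  have hsc : Measurable (trainedScore Aqu εlo εup z) :=
    (measurable_trainedScore Aqu εlo εup _).comp measurable_prodMk_left
  rw [← ofReal_measureReal]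
  exact ENNReal.ofReal_le_ofReal (measureReal_exceedSet_le hsc hM hε hδ hz)

end Conformal

/-! ### Rejection sampling produces the target law. -/

section Rejection

variable {𝒮 𝒜 : Type*} [MeasurableSpace 𝒮] [MeasurableSpace 𝒜] {ν : Measure 𝒜}

/-- Both densities integrate to 1, so integrate the domination inequality over actions. -/
lemma one_le_of_mem_dominatingConstants [Nonempty 𝒮] {πe πb : Policy 𝒮 ν} {b : ℝ}
    (hb : b ∈ dominatingConstants πe πb) : 1 ≤ b := by
  obtain ⟨s⟩ := ‹Nonempty 𝒮›
  have h : (1 : ℝ≥0∞) ≤ ENNReal.ofReal b := by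
    calc (1 : ℝ≥0∞) = ∫⁻ a, (πe.density s a : ℝ≥0∞) ∂ν := (πe.lintegral_density s).symm
      _ ≤ ∫⁻ a, ENNReal.ofReal b * (πb.density s a : ℝ≥0∞) ∂ν := by
        refine lintegral_mono fun a => ?_
        have h1 := ENNReal.ofReal_le_ofReal (hb s a)
        rwa [ENNReal.ofReal_mul' (NNReal.coe_nonneg _), ENNReal.ofReal_coe_nnreal,
          ENNReal.ofReal_coe_nnreal] at h1
      _ = ENNReal.ofReal b := by
        have hm : Measurable fun a => (πb.density s a : ℝ≥0∞) :=
          measurable_coe_nnreal_ennreal.comp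
            (πb.measurable_density.comp measurable_prodMk_left)
        rw [lintegral_const_mul _ hm, πb.lintegral_density, mul_one]
  simpa using h

lemma one_le_boundB [Nonempty 𝒮] {πe πb : Policy 𝒮 ν} (hB : (dominatingConstants πe πb).Nonempty) :
    1 ≤ boundB πe πb :=
  le_csInf hB fun _ hb => one_le_of_mem_dominatingConstants hb

/-- Ensures w / B ≤ 1, so that a uniform variable falls below it with probability exactly w / B. -/
lemma weight_le_boundB {πe πb : Policy 𝒮 ν} [Nonempty 𝒮]
    (hB : (dominatingConstants πe πb).Nonempty) (s : 𝒮) (a : 𝒜) :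
    weight πe πb s a ≤ boundB πe πb := by
  refine le_csInf hB fun b hb => ?_
  exact div_le_of_le_mul₀ (NNReal.coe_nonneg _)
    (zero_le_one.trans (one_le_of_mem_dominatingConstants hb)) (hb s a)

lemma measurable_weight (πe πb : Policy 𝒮 ν) :
    Measurable fun x : 𝒮 × 𝒜 => weight πe πb x.1 x.2 :=
  πe.measurable_density.coe_nnreal_real.div πb.measurable_density.coe_nnreal_real

/-- Where π_b vanishes, domination forces π_e to vanish too, so the convention 0/0 = 0 loses no
mass. -/
lemma ofReal_weight_mul_density {πe πb : Policy 𝒮 ν}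
    (hB : (dominatingConstants πe πb).Nonempty) (s : 𝒮) (a : 𝒜) :
    (πb.density s a : ℝ≥0∞) * ENNReal.ofReal (weight πe πb s a) = πe.density s a := by
  have h : (πb.density s a : ℝ) * weight πe πb s a = πe.density s a := by
    unfold weight
    by_cases h0 : (πb.density s a : ℝ) = 0
    · obtain ⟨b, hb⟩ := hB
      have h1 := hb s a
      rw [h0, mul_zero] at h1
      rw [h0, zero_mul]
      exact le_antisymm (NNReal.coe_nonneg _) h1
    · field_simp
  rw [← ENNReal.ofReal_coe_nnreal, ← ENNReal.ofReal_coe_nnreal,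
    ← ENNReal.ofReal_mul (NNReal.coe_nonneg _), h]

/-- The acceptance event of rejection sampling. -/
def acceptSet (πe πb : Policy 𝒮 ν) : Set (((𝒮 × 𝒜) × ℝ) × ℝ) :=
  {x | x.2 ≤ (1 / boundB πe πb) * weight πe πb x.1.1.1 x.1.1.2}

lemma measurableSet_acceptSet (πe πb : Policy 𝒮 ν) : MeasurableSet (acceptSet πe πb) :=
  measurableSet_le measurable_snd
    (((measurable_weight πe πb).comp (measurable_fst.comp measurable_fst)).const_mul _)

lemma volume_restrict_Icc_Iic {c : ℝ} (hc : c ≤ 1) :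
    (volume.restrict (Set.Icc (0 : ℝ) 1)) {v | v ≤ c} = ENNReal.ofReal c := by
  change (volume.restrict (Set.Icc (0 : ℝ) 1)) (Set.Iic c) = _
  rw [Measure.restrict_apply measurableSet_Iic]
  have : Set.Iic c ∩ Set.Icc 0 1 = Set.Icc 0 c := by
    ext v
    simp only [Set.mem_inter_iff, Set.mem_Iic, Set.mem_Icc]
    constructor
    · rintro ⟨h1, h2, -⟩; exact ⟨h2, h1⟩
    · rintro ⟨h1, h2⟩; exact ⟨h2, h1, h2.trans hc⟩
  rw [this, Real.volume_Icc, sub_zero]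

variable [SFinite ν] (PS : Measure 𝒮) [IsProbabilityMeasure PS]
  (PR : Kernel (𝒮 × 𝒜) ℝ) [IsMarkovKernel PR]

instance isProbabilityMeasure_observationLaw (π : Policy 𝒮 ν) :
    IsProbabilityMeasure (observationLaw PS PR π) := by
  unfold observationLaw; infer_instance

instance isProbabilityMeasure_contextRewardLaw (π : Policy 𝒮 ν) :
    IsProbabilityMeasure (contextRewardLaw PS PR π) :=
  Measure.isProbabilityMeasure_map (by fun_prop)

lemma lintegral_observationLaw (π : Policy 𝒮 ν) {g : (𝒮 × 𝒜) × ℝ → ℝ≥0∞} (hg : Measurable g) :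
    ∫⁻ x, g x ∂observationLaw PS PR π
      = ∫⁻ s, ∫⁻ a, (π.density s a : ℝ≥0∞) * ∫⁻ r, g ((s, a), r) ∂PR (s, a) ∂ν ∂PS := by
  have hm : Measurable (Function.uncurry fun s a => (π.density s a : ℝ≥0∞)) :=
    measurable_coe_nnreal_ennreal.comp π.measurable_density
  have hg2 : Measurable fun x : 𝒮 × 𝒜 => ∫⁻ r, g (x, r) ∂PR x :=
    Measurable.lintegral_kernel_prod_right hg
  rw [observationLaw, Measure.lintegral_compProd hg, Measure.lintegral_compProd hg2]
  refine lintegral_congr fun s => ?_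
  have hg3 : Measurable fun a => ∫⁻ r, g ((s, a), r) ∂PR (s, a) := hg2.comp measurable_prodMk_left
  rw [Policy.kernel, Kernel.lintegral_withDensity _ hm _ hg3, Kernel.const_apply]

/-- Change of measure between the behavior and the target policy. -/
lemma lintegral_mul_weight {πe πb : Policy 𝒮 ν} (hB : (dominatingConstants πe πb).Nonempty)
    {g : (𝒮 × 𝒜) × ℝ → ℝ≥0∞} (hg : Measurable g) :
    ∫⁻ x, ENNReal.ofReal (weight πe πb x.1.1 x.1.2) * g x ∂observationLaw PS PR πb
      = ∫⁻ x, g x ∂observationLaw PS PR πe := by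
  have hw : Measurable fun x : (𝒮 × 𝒜) × ℝ => ENNReal.ofReal (weight πe πb x.1.1 x.1.2) :=
    (measurable_weight πe πb).ennreal_ofReal.comp measurable_fst
  have hwg : Measurable fun x : (𝒮 × 𝒜) × ℝ => ENNReal.ofReal (weight πe πb x.1.1 x.1.2) * g x :=
    hw.mul hg
  rw [lintegral_observationLaw PS PR πe hg, lintegral_observationLaw PS PR πb hwg]
  refine lintegral_congr fun s => lintegral_congr fun a => ?_
  have hgs : Measurable fun r => g ((s, a), r) := hg.comp measurable_prodMk_left
  dsimp only
  rw [lintegral_const_mul _ hgs, ← mul_assoc,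
    ofReal_weight_mul_density hB]

/-- An accepted pair (context, reward) has the target distribution; the acceptance probability is
`1 / B`. -/
lemma restrict_acceptSet_map {πe πb : Policy 𝒮 ν} (hB : (dominatingConstants πe πb).Nonempty) :
    (((observationLaw PS PR πb).prod (volume.restrict (Set.Icc (0 : ℝ) 1))).restrict
      (acceptSet πe πb)).map (fun x => (x.1.1.1, x.1.2))
      = (1 / boundB πe πb).toNNReal • contextRewardLaw PS PR πe := by
  have : Nonempty 𝒮 := PS.nonempty_of_neZero
  have hB1 := one_le_boundB hB
  have hpair : Measurable fun x : (𝒮 × 𝒜) × ℝ => (x.1.1, x.2) := by fun_prop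
  ext F hF
  have hf : Measurable fun x : ((𝒮 × 𝒜) × ℝ) × ℝ => (x.1.1.1, x.1.2) := by fun_prop
  rw [Measure.map_apply hf hF, Measure.restrict_apply (hf hF),
    Measure.prod_apply ((hf hF).inter (measurableSet_acceptSet πe πb))]
  -- Integrate out the uniform variable first: acceptance contributes the factor w / B, and w is
  -- then absorbed by the change of measure.
  have hsec : ∀ x : (𝒮 × 𝒜) × ℝ, (volume.restrict (Set.Icc (0 : ℝ) 1))
      (Prod.mk x ⁻¹' ((fun x : ((𝒮 × 𝒜) × ℝ) × ℝ => (x.1.1.1, x.1.2)) ⁻¹' F ∩ acceptSet πe πb))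
      = ENNReal.ofReal (1 / boundB πe πb) * (ENNReal.ofReal (weight πe πb x.1.1 x.1.2)
        * ((fun x : (𝒮 × 𝒜) × ℝ => (x.1.1, x.2)) ⁻¹' F).indicator 1 x) := by
    intro x
    by_cases hx : (x.1.1, x.2) ∈ F
    · rw [Set.indicator_of_mem (by exact hx), Pi.one_apply, mul_one,
        ← ENNReal.ofReal_mul (by positivity), ← volume_restrict_Icc_Iic]
      · congr 1
        ext v
        simp [hx, acceptSet]
      · rw [one_div, inv_mul_le_iff₀ (by linarith), mul_one]
        exact weight_le_boundB hB _ _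
    · rw [Set.indicator_of_notMem (by exact hx), mul_zero, mul_zero]
      refine (congrArg _ ?_).trans measure_empty
      ext v
      simp [hx]
  simp_rw [hsec]
  have hind : Measurable (((fun x : (𝒮 × 𝒜) × ℝ => (x.1.1, x.2)) ⁻¹' F).indicator
      (1 : (𝒮 × 𝒜) × ℝ → ℝ≥0∞)) := measurable_one.indicator (hpair hF)
  have hw : Measurable fun x : (𝒮 × 𝒜) × ℝ => ENNReal.ofReal (weight πe πb x.1.1 x.1.2) :=
    (measurable_weight πe πb).ennreal_ofReal.comp measurable_fst
  have hwi : Measurable fun x : (𝒮 × 𝒜) × ℝ => ENNReal.ofReal (weight πe πb x.1.1 x.1.2)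
      * ((fun x : (𝒮 × 𝒜) × ℝ => (x.1.1, x.2)) ⁻¹' F).indicator 1 x := hw.mul hind
  rw [lintegral_const_mul _ hwi, lintegral_mul_weight PS PR hB hind,
    lintegral_indicator_one (hpair hF), contextRewardLaw, Measure.smul_apply,
    Measure.map_apply hpair hF]
  rfl

end Rejection

/-! ### Averaging the fixed-size bound over the binomial size N. -/

section Arithmetic

/-- By C(n, N)/(N + 1) = C(n + 1, N + 1)/(n + 1), the sum is the probability that Bin(n + 1, p) is
positive, divided by (n + 1)p. -/
lemma sum_binomial_div_le (n : ℕ) {p : ℝ} (hp0 : 0 < p) (hp1 : p ≤ 1) :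
    ∑ N ∈ Finset.range (n + 1), (n.choose N : ℝ) * (p ^ N * (1 - p) ^ (n - N)) * (1 / (N + 1))
      ≤ 1 / ((n + 1) * p) := by
  have hq : 0 ≤ 1 - p := by linarith
  have h : ∀ N ∈ Finset.range (n + 1),
      (n.choose N : ℝ) * (p ^ N * (1 - p) ^ (n - N)) * (1 / (N + 1))
      = (p ^ (N + 1) * (1 - p) ^ (n + 1 - (N + 1)) * ((n + 1).choose (N + 1) : ℝ))
        * (1 / ((n + 1) * p)) := by
    intro N _
    have hc : ((n : ℝ) + 1) * n.choose N = (n + 1).choose (N + 1) * (N + 1) := by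
      exact_mod_cast Nat.add_one_mul_choose_eq n N
    rw [Nat.add_sub_add_right]
    have hc' : (n.choose N : ℝ) * (1 / (N + 1)) = (n + 1).choose (N + 1) * (1 / (n + 1)) := by
      rw [mul_one_div, mul_one_div, div_eq_div_iff (by positivity) (by positivity)]
      linear_combination hc
    have hp : p * (1 / ((n + 1) * p)) = 1 / ((n : ℝ) + 1) := by field_simp
    rw [pow_succ]
    linear_combination p ^ N * (1 - p) ^ (n - N) * hc'
      - p ^ N * (1 - p) ^ (n - N) * ((n + 1).choose (N + 1) : ℝ) * hp
  rw [Finset.sum_congr rfl h, ← Finset.sum_mul]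
  refine mul_le_of_le_one_left (by positivity) ?_
  have hb := add_pow p (1 - p) (n + 1)
  rw [add_sub_cancel, one_pow, Finset.sum_range_succ'] at hb
  have : 0 ≤ p ^ 0 * (1 - p) ^ (n + 1 - 0) * ((n + 1).choose 0 : ℝ) := by positivity
  linarith

lemma sum_binomial (n : ℕ) (p : ℝ) :
    ∑ N ∈ Finset.range (n + 1), (n.choose N : ℝ) * (p ^ N * (1 - p) ^ (n - N)) = 1 := by
  have hb := add_pow p (1 - p) n
  rw [add_sub_cancel, one_pow] at hb
  refine Eq.trans (Finset.sum_congr rfl fun i _ => ?_) hb.symm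
  ring

/-- The bound for a sample of size `N`: no information when `N = 0`. -/
noncomputable def sizeBound (γ ε δ : ℝ) (N : ℕ) : ℝ :=
  if N = 0 then 1 else 1 - δ + 1 / √(⌈γ * (N : ℝ)⌉₊ * ε * (1 - ε))

/-- Linearizes 1/√N in 1/(N + 1), whose binomial mean is explicit. With x = 1/√N, (√n x - 1)² ≥ 0
gives 2x ≤ √n/N + 1/√n, and 1/N ≤ 2/(N + 1). The extra 1/(N + 1) pays for the trivial bound at N =
0. -/
lemma sizeBound_le {γ ε δ : ℝ} (hγ : 0 < γ) (hε : ε ∈ Set.Ioo (0 : ℝ) 1)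
    (hδ : δ ∈ Set.Ioo (0 : ℝ) 1) {n : ℕ} (hn : 1 ≤ n) (N : ℕ) :
    sizeBound γ ε δ N ≤ (1 - δ + 1 / √(γ * ε * (1 - ε)) * (1 / √n))
      + (1 + 1 / √(γ * ε * (1 - ε)) * √n) * (1 / (N + 1)) := by
  have hε0 := hε.1
  have hq : 0 < 1 - ε := by linarith [hε.2]
  have hn' : (0 : ℝ) < n := by exact_mod_cast hn
  set a := 1 / √(γ * ε * (1 - ε)) with ha
  have ha0 : 0 < a := by positivity
  unfold sizeBound
  split_ifs with hN
  · subst hN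
    have h1 : 0 ≤ a * (1 / √n) := by positivity
    have h2 : 0 ≤ a * √n := by positivity
    simp only [CharP.cast_eq_zero, zero_add, div_one, mul_one]
    simp only [one_div] at h1 ⊢
    linarith [hδ.2]
  · have hN1 : (1 : ℝ) ≤ N := by exact_mod_cast Nat.one_le_iff_ne_zero.2 hN
    have h1 : 1 / √(⌈γ * (N : ℝ)⌉₊ * ε * (1 - ε)) ≤ a * (1 / √N) := by
      rw [ha, one_div_mul_one_div, ← Real.sqrt_mul (by positivity)]
      refine one_div_le_one_div_of_le (by positivity) (Real.sqrt_le_sqrt ?_)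
      have := Nat.le_ceil (γ * (N : ℝ))
      have h2 := mul_le_mul_of_nonneg_right this (mul_pos hε0 hq).le
      nlinarith
    have h2 : 1 / √N ≤ √n * (1 / (N + 1)) + 1 / √n := by
      have hx : 0 < 1 / √(N : ℝ) := by positivity
      have hy : 0 < √(n : ℝ) := by positivity
      have hsq : (1 / √(N : ℝ)) ^ 2 = 1 / N := by
        rw [div_pow, Real.sq_sqrt (by positivity), one_pow]
      have h3 : 1 / (N : ℝ) ≤ 2 * (1 / (N + 1)) := by
        rw [mul_one_div, div_le_div_iff₀ (by linarith) (by linarith)]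
        linarith
      have h4 : 2 * (1 / √(N : ℝ)) ≤ √n * (1 / √(N : ℝ)) ^ 2 + 1 / √n := by
        have h5 := sq_nonneg (√n * (1 / √(N : ℝ)) - 1)
        have h6 : √n * (2 * (1 / √(N : ℝ))) ≤ √n * (√n * (1 / √(N : ℝ)) ^ 2 + 1 / √n) := by
          rw [mul_add, mul_one_div_cancel hy.ne']
          nlinarith
        exact le_of_mul_le_mul_left h6 hy
      rw [hsq] at h4
      have h7 := mul_le_mul_of_nonneg_left h3 hy.le
      have h8 : 0 ≤ 1 / √(n : ℝ) := by positivity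
      linarith
    have h3 := mul_le_mul_of_nonneg_left h2 ha0.le
    have h4 : 0 ≤ 1 / ((N : ℝ) + 1) := by positivity
    nlinarith

lemma sum_sizeBound_lt {γ ε δ B : ℝ} (hγ : γ ∈ Set.Ioo (0 : ℝ) 1) (hε : ε ∈ Set.Ioo (0 : ℝ) 1)
    (hδ : δ ∈ Set.Ioo (0 : ℝ) 1) (hB : 1 ≤ B) {n : ℕ} (hn : 1 ≤ n) :
    ∑ N ∈ Finset.range (n + 1),
        (n.choose N : ℝ) * ((1 / B) ^ N * (1 - 1 / B) ^ (n - N) * sizeBound γ ε δ N)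
      < 1 - δ + constC B γ ε δ / √n := by
  have hε0 := hε.1
  have hγ0 := hγ.1
  have hq : 0 < 1 - ε := by linarith [hε.2]
  have hn' : (0 : ℝ) < n := by exact_mod_cast hn
  have hB0 : 0 < B := by linarith
  have hp0 : 0 < 1 / B := by positivity
  have hp1 : 1 / B ≤ 1 := by rw [div_le_one hB0]; exact hB
  have hpq : 0 ≤ 1 - 1 / B := by linarith
  set a := 1 / √(γ * ε * (1 - ε)) with ha
  have ha0 : 0 < a := by positivity
  have h1 : ∑ N ∈ Finset.range (n + 1),
        (n.choose N : ℝ) * ((1 / B) ^ N * (1 - 1 / B) ^ (n - N) * sizeBound γ ε δ N)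
      ≤ (1 - δ + a * (1 / √n)) + (1 + a * √n) * (1 / ((n + 1) * (1 / B))) := by
    calc _ ≤ ∑ N ∈ Finset.range (n + 1),
        ((1 - δ + a * (1 / √n)) * ((n.choose N : ℝ) * ((1 / B) ^ N * (1 - 1 / B) ^ (n - N)))
          + (1 + a * √n) * ((n.choose N : ℝ) * ((1 / B) ^ N * (1 - 1 / B) ^ (n - N))
            * (1 / (N + 1)))) := by
          refine Finset.sum_le_sum fun N _ => ?_
          have hw : 0 ≤ (n.choose N : ℝ) * ((1 / B) ^ N * (1 - 1 / B) ^ (n - N)) := by positivity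
          have := mul_le_mul_of_nonneg_left (sizeBound_le hγ0 hε hδ hn N) hw
          refine le_of_eq_of_le (by ring) (this.trans_eq ?_)
          rw [← ha]; ring
      _ ≤ _ := by
          rw [Finset.sum_add_distrib, ← Finset.mul_sum, ← Finset.mul_sum, sum_binomial, mul_one]
          gcongr
          exact sum_binomial_div_le n hp0 hp1
  refine h1.trans_lt ?_
  set r := √(n : ℝ) with hr
  have hr0 : 0 < r := by positivity
  have hrn : (n : ℝ) = r ^ 2 := (Real.sq_sqrt hn'.le).symm
  -- The middle term of C is needed only to be nonnegative.
  have hC : 7 * B * a + B / 2 ≤ constC B γ ε δ := by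
    unfold constC
    have := Real.sqrt_nonneg ((⌊Real.logb (1 - ε) δ / γ⌋ : ℝ) * B)
    have h2 : 7 * B * a = 7 * B / √(γ * ε * (1 - ε)) := by rw [ha]; ring
    linarith
  -- AM-GM, n + 1 ≥ 2√n: this is the origin of B/2. The a-terms total at most 2aB/√n, against 7aB/√n
  -- available, so the inequality is strict.
  have h2 : 1 / (((n : ℝ) + 1) * (1 / B)) ≤ B / 2 / r := by
    rw [hrn, div_div, div_le_div_iff₀ (by positivity) (by positivity)]
    have : ((r ^ 2 + 1) * (1 / B)) * B = r ^ 2 + 1 := by field_simp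
    nlinarith [sq_nonneg (r - 1)]
  have h3 : r * (1 / (((n : ℝ) + 1) * (1 / B))) ≤ B / r := by
    rw [hrn, mul_one_div, div_le_div_iff₀ (by positivity) (by positivity)]
    have : B * ((r ^ 2 + 1) * (1 / B)) = r ^ 2 + 1 := by field_simp
    nlinarith
  have h4 : (7 * B * a + B / 2) / r ≤ constC B γ ε δ / r := by gcongr
  have h5 := mul_le_mul_of_nonneg_left h3 ha0.le
  have h6 : a * (1 / r) ≤ a * (B / r) := by gcongr
  have h7 : 0 < a * (B / r) := by positivity
  have h8 : (7 * B * a + B / 2) / r = 7 * (a * (B / r)) + B / 2 / r := by ring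
  linarith

end Arithmetic

/-! ### Conditional probability under independence. -/

section ConditionalProbability

/-- The conditional probability, given `X`, of an event about `X` and an independent `T`. -/
lemma condExp_indicator_ae_eq_of_indepFun {Ω α β : Type*} {mΩ : MeasurableSpace Ω}
    [MeasurableSpace α] [MeasurableSpace β] {P : Measure Ω} [IsProbabilityMeasure P]
    {X : Ω → α} {T : Ω → β} (hX : Measurable X) (hT : Measurable T) (h : IndepFun X T P)
    {E : Set (α × β)} (hE : MeasurableSet E) :
    (P⟦{ω | (X ω, T ω) ∈ E} | MeasurableSpace.comap X inferInstance⟧)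
      =ᵐ[P] fun ω => (P.map T).real (Prod.mk (X ω) ⁻¹' E) := by
  have : IsProbabilityMeasure (P.map T) := Measure.isProbabilityMeasure_map hT.aemeasurable
  have : IsProbabilityMeasure (P.map X) := Measure.isProbabilityMeasure_map hX.aemeasurable
  have hsec : Measurable fun x => (P.map T) (Prod.mk x ⁻¹' E) := measurable_measure_prodMk_left hE
  have hevent : MeasurableSet {ω | (X ω, T ω) ∈ E} := (hX.prodMk hT) hE
  have hint : Integrable (fun ω => (P.map T).real (Prod.mk (X ω) ⁻¹' E)) P :=
    Integrable.of_bound (hsec.ennreal_toReal.comp hX).aestronglyMeasurable 1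
      (Filter.Eventually.of_forall fun ω => by
        simp [abs_of_nonneg])
  symm
  refine ae_eq_condExp_of_forall_setIntegral_eq hX.comap_le
    ((integrable_const 1).indicator hevent) (fun s _ _ => hint.integrableOn) ?_ ?_
  · rintro _ ⟨S, hS, rfl⟩ -
    rw [setIntegral_indicator hevent, setIntegral_const, smul_eq_mul, mul_one]
    change ∫ ω in X ⁻¹' S, ((P.map T) (Prod.mk (X ω) ⁻¹' E)).toReal ∂P = _
    have hsecX : Measurable fun ω => (P.map T) (Prod.mk (X ω) ⁻¹' E) := hsec.comp hX
    rw [integral_toReal hsecX.aemeasurable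
      (Filter.Eventually.of_forall fun ω => measure_lt_top _ _), measureReal_def]
    congr 1
    have hprod : P.map (fun ω => (X ω, T ω)) = (P.map X).prod (P.map T) :=
      (indepFun_iff_map_prod_eq_prod_map_map hX.aemeasurable hT.aemeasurable).1 h
    have h1 : X ⁻¹' S ∩ {ω | (X ω, T ω) ∈ E} = (fun ω => (X ω, T ω)) ⁻¹' (Prod.fst ⁻¹' S ∩ E) := rfl
    have hSE : MeasurableSet (Prod.fst ⁻¹' S ∩ E : Set (α × β)) := (measurable_fst hS).inter hE
    rw [h1, ← Measure.map_apply (hX.prodMk hT) hSE, hprod, Measure.prod_apply hSE,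
      ← setLIntegral_map hS hsec hX, ← lintegral_indicator hS]
    refine lintegral_congr fun x => ?_
    by_cases hx : x ∈ S
    · rw [Set.indicator_of_mem hx]
      congr 1
      ext t
      simp [hx]
    · rw [Set.indicator_of_notMem hx, eq_comm]
      refine (congrArg _ ?_).trans measure_empty
      ext t
      simp [hx]
  · exact (hsec.ennreal_toReal.comp (comap_measurable X)).aestronglyMeasurable

end ConditionalProbability

/-! ### Decomposition over the set of accepted indices. -/

section Main

variable {𝒮 𝒜 : Type*} [MeasurableSpace 𝒮] [MeasurableSpace 𝒜] {ν : Measure 𝒜}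

lemma accepted_eq_iff (πe πb : Policy 𝒮 ν) {n : ℕ} (d : Fin n → (𝒮 × 𝒜) × ℝ) (v : Fin n → ℝ)
    (I : Finset (Fin n)) :
    accepted πe πb d v = I ↔ ∀ i, i ∈ I ↔ (d i, v i) ∈ acceptSet πe πb := by
  rw [Finset.ext_iff]
  refine forall_congr' fun i => ?_
  simp only [accepted, Finset.mem_filter, Finset.mem_univ, true_and]
  exact iff_comm

/-- The context and reward of an observation with its auxiliary uniform number. -/
def contextReward (x : ((𝒮 × 𝒜) × ℝ) × ℝ) : 𝒮 × ℝ := (x.1.1.1, x.1.2)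

lemma measurable_contextReward : Measurable (contextReward : ((𝒮 × 𝒜) × ℝ) × ℝ → 𝒮 × ℝ) := by
  unfold contextReward; fun_prop

/-- A property of the accepted sample, according to the set of accepted indices. -/
lemma rejectionSample_iff (πe πb : Policy 𝒮 ν) {n : ℕ} (Q : ∀ N, (Fin N → 𝒮 × ℝ) → Prop)
    (d : Fin n → (𝒮 × 𝒜) × ℝ) (v : Fin n → ℝ) :
    Q _ (rejectionSample πe πb d v) ↔ ∃ I : Finset (Fin n),
      (∀ i, i ∈ I ↔ (d i, v i) ∈ acceptSet πe πb)
        ∧ Q I.card (subsample I fun i => contextReward (d i, v i)) := by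
  constructor
  · intro h
    exact ⟨_, (accepted_eq_iff πe πb d v _).1 rfl, h⟩
  · rintro ⟨I, hI, h⟩
    obtain rfl := (accepted_eq_iff πe πb d v I).2 hI
    exact h

/-- The accepted sample has random length; splitting over the finitely many possible accepted sets
reduces to fixed lengths. -/
lemma measurableSet_rejectionSample (πe πb : Policy 𝒮 ν) (n : ℕ) {T : Type*} [MeasurableSpace T]
    {Q : ∀ N, (Fin N → 𝒮 × ℝ) → T → Prop}
    (hQ : ∀ N, MeasurableSet {p : (Fin N → 𝒮 × ℝ) × T | Q N p.1 p.2}) :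
    MeasurableSet {z : ((Fin n → (𝒮 × 𝒜) × ℝ) × (Fin n → ℝ)) × T |
      Q _ (rejectionSample πe πb z.1.1 z.1.2) z.2} := by
  simp_rw [fun z : ((Fin n → (𝒮 × 𝒜) × ℝ) × (Fin n → ℝ)) × T =>
    rejectionSample_iff πe πb (fun N y => Q N y z.2) z.1.1 z.1.2, Set.ofPred_exists]
  have hzip : Measurable fun z : ((Fin n → (𝒮 × 𝒜) × ℝ) × (Fin n → ℝ)) × T =>
      fun i => (z.1.1 i, z.1.2 i) := by fun_prop
  refine MeasurableSet.iUnion fun I => MeasurableSet.inter ?_ ?_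
  · exact hzip (measurableSet_pattern (measurableSet_acceptSet πe πb) I)
  · have h1 : Measurable fun z : ((Fin n → (𝒮 × 𝒜) × ℝ) × (Fin n → ℝ)) × T =>
        (subsample I fun i => contextReward (z.1.1 i, z.1.2 i)) := by
      refine measurable_pi_lambda _ fun j => ?_
      exact measurable_contextReward.comp ((measurable_pi_apply (I.orderEmbOfFin rfl j)).comp hzip)
    exact (h1.prodMk measurable_snd) (hQ I.card)

variable [SFinite ν] (PS : Measure 𝒮) [IsProbabilityMeasure PS]
  (PR : Kernel (𝒮 × 𝒜) ℝ) [IsMarkovKernel PR]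

/-- The law of one observation with its auxiliary uniform number. -/
noncomputable def sampleLaw (πb : Policy 𝒮 ν) : Measure (((𝒮 × 𝒜) × ℝ) × ℝ) :=
  (observationLaw PS PR πb).prod (volume.restrict (Set.Icc (0 : ℝ) 1))

instance isProbabilityMeasure_restrict_Icc :
    IsProbabilityMeasure (volume.restrict (Set.Icc (0 : ℝ) 1)) := ⟨by simp⟩

instance isProbabilityMeasure_sampleLaw (πb : Policy 𝒮 ν) :
    IsProbabilityMeasure (sampleLaw PS PR πb) := by
  unfold sampleLaw; infer_instance

variable {πe πb : Policy 𝒮 ν}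

/-- The accepted indices and the accepted sample: given the former, the latter is i.i.d. from the
target distribution. -/
lemma measureReal_accepted_sample (hB : (dominatingConstants πe πb).Nonempty) {n : ℕ}
    (I : Finset (Fin n)) {E : Set (Fin I.card → 𝒮 × ℝ)} (hE : MeasurableSet E) :
    (Measure.pi fun _ : Fin n => sampleLaw PS PR πb).real
        {x | (∀ i, i ∈ I ↔ x i ∈ acceptSet πe πb) ∧ subsample I (fun i => contextReward (x i)) ∈ E}
      = (1 / boundB πe πb) ^ I.card * (1 - 1 / boundB πe πb) ^ (n - I.card)
        * (Measure.pi fun _ => contextRewardLaw PS PR πe).real E := by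
  have : Nonempty 𝒮 := PS.nonempty_of_neZero
  have hB1 := one_le_boundB hB
  have hp : 0 ≤ 1 / boundB πe πb := by positivity
  have hA := measurableSet_acceptSet πe πb
  have hmap : ((sampleLaw PS PR πb).restrict (acceptSet πe πb)).map contextReward
      = (1 / boundB πe πb).toNNReal • contextRewardLaw PS PR πe :=
    restrict_acceptSet_map PS PR hB
  have hprob : (sampleLaw PS PR πb).real (acceptSet πe πb) = 1 / boundB πe πb := by
    have h := congrArg (fun m => m Set.univ) hmap
    simp only [Measure.smul_apply, measure_univ] at h
    rw [Measure.map_apply measurable_contextReward MeasurableSet.univ, Set.preimage_univ,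
      Measure.restrict_apply_univ] at h
    rw [measureReal_def, h]
    simp [ENNReal.smul_def]
    linarith
  rw [measureReal_def, measure_pattern measurable_contextReward hmap I hE hA, ENNReal.toReal_mul,
    ENNReal.toReal_mul, ENNReal.toReal_pow, ENNReal.toReal_pow, ENNReal.coe_toReal,
    Real.coe_toNNReal _ hp, ← measureReal_def, ← measureReal_def, probReal_compl_eq_one_sub hA,
    hprob]

variable {γ : ℝ} (split : SplitRule γ) (Aqu : QuantileAlgorithm 𝒮) (εlo εup : ℝ)

lemma measurableSet_injective_calibrationScores (N : ℕ) :
    MeasurableSet {y : Fin N → 𝒮 × ℝ |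
      Function.Injective (calibrationScores split Aqu εlo εup y)} := by
  have hm (i : Fin (split.calib N).card) :
      Measurable fun y : Fin N → 𝒮 × ℝ => calibrationScores split Aqu εlo εup y i :=
    (measurable_trainedScore Aqu εlo εup _).comp
      ((measurable_subsample (split.calib N)ᶜ).prodMk
        (measurable_pi_apply ((split.calib N).orderEmbOfFin rfl i)))
  simp_rw [Function.Injective, Set.ofPred_forall]
  refine MeasurableSet.iInter fun a => MeasurableSet.iInter fun b => ?_
  by_cases hab : a = b
  · simp [hab]
  · simp only [hab, imp_false]
    exact (measurableSet_eq_fun (hm a) (hm b)).compl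

lemma measureReal_missSet_rejectionSample_lt (hB : (dominatingConstants πe πb).Nonempty)
    {ε δ : ℝ} (hε : ε ∈ Set.Ioo (0 : ℝ) 1) (hδ : δ ∈ Set.Ioo (0 : ℝ) 1)
    (hγ : γ ∈ Set.Ioo (0 : ℝ) 1) {n : ℕ} (hn : 1 ≤ n)
    (hties : ∀ᵐ x ∂(Measure.pi fun _ : Fin n => sampleLaw PS PR πb),
      Function.Injective (calibrationScores split Aqu εlo εup
        (rejectionSample πe πb (fun i => (x i).1) (fun i => (x i).2)))) :
    (Measure.pi fun _ : Fin n => sampleLaw PS PR πb).real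
        {x | (contextRewardLaw PS PR πe).real (missSet split Aqu εlo εup ε δ
          (rejectionSample πe πb (fun i => (x i).1) (fun i => (x i).2))) ≤ ε}
      < 1 - δ + constC (boundB πe πb) γ ε δ / √n := by
  have : Nonempty 𝒮 := PS.nonempty_of_neZero
  have hB1 := one_le_boundB hB
  set μ := contextRewardLaw PS PR πe
  set p := 1 / boundB πe πb with hp
  have hp0 : 0 < p := by positivity
  have hp1 : 0 ≤ 1 - p := by
    rw [hp, sub_nonneg, div_le_one (by linarith)]; exact hB1
  have hmeas (N : ℕ) : MeasurableSet
      {y : Fin N → 𝒮 × ℝ | μ.real (missSet split Aqu εlo εup ε δ y) ≤ ε} :=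
    measurableSet_le (measurable_measure_prodMk_left
      (measurableSet_missSet split Aqu εlo εup ε hδ.1.le N)).ennreal_toReal measurable_const
  have hset : {x : Fin n → ((𝒮 × 𝒜) × ℝ) × ℝ | μ.real (missSet split Aqu εlo εup ε δ
      (rejectionSample πe πb (fun i => (x i).1) (fun i => (x i).2))) ≤ ε}
      = ⋃ I ∈ (Finset.univ : Finset (Fin n)).powerset, {x | (∀ i, i ∈ I ↔ x i ∈ acceptSet πe πb) ∧
        subsample I (fun i => contextReward (x i))
          ∈ {y | μ.real (missSet split Aqu εlo εup ε δ y) ≤ ε}} := by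
    ext x
    simp only [Set.mem_iUnion, Finset.mem_powerset, Finset.subset_univ, exists_true_left]
    exact rejectionSample_iff πe πb (fun N y => μ.real (missSet split Aqu εlo εup ε δ y) ≤ ε) _ _
  have hterm (I : Finset (Fin n)) : p ^ I.card * (1 - p) ^ (n - I.card)
      * (Measure.pi fun _ : Fin I.card => μ).real
        {y | μ.real (missSet split Aqu εlo εup ε δ y) ≤ ε}
      ≤ p ^ I.card * (1 - p) ^ (n - I.card) * sizeBound γ ε δ I.card := by
    have hw : 0 ≤ p ^ I.card * (1 - p) ^ (n - I.card) := by positivity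
    -- If the pattern has probability zero (B = 1 and I not full), the no-ties hypothesis says
    -- nothing about size |I|, but the term vanishes.
    rcases hw.eq_or_lt with hw0 | hw0
    · rw [← hw0, zero_mul, zero_mul]
    refine mul_le_mul_of_nonneg_left ?_ hw
    unfold sizeBound
    split_ifs with hI
    · exact measureReal_le_one
    refine measureReal_missSet_le split Aqu εlo εup hε hδ ?_ ?_
    · rw [Nat.one_le_ceil_iff]
      have : (0 : ℝ) < I.card := by exact_mod_cast Nat.pos_of_ne_zero hI
      exact mul_pos hγ.1 this
    -- The probability of ties together with pattern I factors; as the pattern has positive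
    -- probability, an i.i.d. target sample of size |I| has almost surely no ties.
    · have h := measureReal_accepted_sample PS PR hB I
        (measurableSet_injective_calibrationScores split Aqu εlo εup I.card).compl
      have hzero : (Measure.pi fun _ : Fin n => sampleLaw PS PR πb).real
          {x | (∀ i, i ∈ I ↔ x i ∈ acceptSet πe πb) ∧ subsample I (fun i => contextReward (x i))
            ∈ {y | Function.Injective (calibrationScores split Aqu εlo εup y)}ᶜ} = 0 := by
        rw [measureReal_eq_zero_iff]
        refine measure_mono_null (fun x hx => ?_) hties
        exact (rejectionSample_iff πe πb
          (fun N y => ¬ Function.Injective (calibrationScores split Aqu εlo εup y)) _ _).2 ⟨I, hx⟩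
      rw [hzero, eq_comm] at h
      exact (measureReal_eq_zero_iff).1 ((mul_eq_zero.1 h).resolve_left hw0.ne')
  refine lt_of_le_of_lt ?_ (sum_sizeBound_lt hγ hε hδ hB1 hn)
  rw [hset]
  refine (measureReal_biUnion_finset_le _ _).trans ?_
  simp_rw [fun I : Finset (Fin n) => measureReal_accepted_sample PS PR hB I (hmeas I.card)]
  refine (Finset.sum_le_sum fun I _ => hterm I).trans_eq ?_
  rw [Finset.sum_powerset_apply_card
    (fun N => p ^ N * (1 - p) ^ (n - N) * sizeBound γ ε δ N), Finset.card_univ, Fintype.card_fin]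
  simp only [nsmul_eq_mul, hp]

end Main

end OffPolicy

/-! ### Transfer to the given probability space. -/

theorem theorem2
    {𝒮 𝒜 : Type*} [MeasurableSpace 𝒮] [MeasurableSpace 𝒜]
    -- the bandit, the two policies, and the assumption that `B` is finite
    (ν : Measure 𝒜) [SFinite ν]
    (PS : Measure 𝒮) [IsProbabilityMeasure PS]
    (PR : Kernel (𝒮 × 𝒜) ℝ) [IsMarkovKernel PR]
    (πb πe : Policy 𝒮 ν)
    (hB : (dominatingConstants πe πb).Nonempty)
    -- the parameters of the algorithm
    (ε δ γ : ℝ) (hε : ε ∈ Set.Ioo (0 : ℝ) 1) (hδ : δ ∈ Set.Ioo (0 : ℝ) 1)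
    (hγ : γ ∈ Set.Ioo (0 : ℝ) 1)
    (εlo εup : ℝ) (hlevels : εup - εlo = 1 - ε)
    (split : SplitRule γ) (Aqu : QuantileAlgorithm 𝒮)
    -- the observations `D`, the uniform variables `V` and the test pair `(S', R')`
    {Ω : Type*} [MeasurableSpace Ω] (P : Measure Ω) [IsProbabilityMeasure P]
    (n : ℕ) (hn : 1 ≤ n)
    (D : Fin n → Ω → (𝒮 × 𝒜) × ℝ) (V : Fin n → Ω → ℝ) (S' : Ω → 𝒮) (R' : Ω → ℝ)
    (hD_meas : ∀ i, Measurable (D i)) (hV_meas : ∀ i, Measurable (V i))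
    (hS'_meas : Measurable S') (hR'_meas : Measurable R')
    (hD_law : ∀ i, P.map (D i) = observationLaw PS PR πb) (hD_indep : iIndepFun D P)
    (hV_law : ∀ i, pdf.IsUniform (V i) (Set.Icc 0 1) P) (hV_indep : iIndepFun V P)
    (hDV_indep : IndepFun (fun ω i => D i ω) (fun ω i => V i ω) P)
    (hT_law : P.map (fun ω => (S' ω, R' ω)) = contextRewardLaw PS PR πe)
    (hT_indep : IndepFun (fun ω => (S' ω, R' ω))
      (fun ω => ((fun i => D i ω), (fun i => V i ω))) P)
    -- almost surely, there are no ties among the scores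
    (hties : ∀ᵐ ω ∂P, Function.Injective (calibrationScores split Aqu εlo εup
      (rejectionSample πe πb (fun i => D i ω) (fun i => V i ω)))) :
    -- the conditional miscoverage given the data and the auxiliary uniform variables
    let L : Ω → ℝ :=
      P⟦{ω | R' ω ∉ predictionInterval πe πb split Aqu εlo εup ε δ
            (fun i => D i ω) (fun i => V i ω) (S' ω)} |
        MeasurableSpace.comap (fun ω => ((fun i => D i ω), (fun i => V i ω))) inferInstance⟧
    P.real {ω | L ω ≤ ε} < 1 - δ + constC (boundB πe πb) γ ε δ / √(n : ℝ) := by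
  intro L
  set μ := contextRewardLaw PS PR πe
  set X : Ω → (Fin n → (𝒮 × 𝒜) × ℝ) × (Fin n → ℝ) :=
    fun ω => ((fun i => D i ω), (fun i => V i ω)) with hXdef
  have hX : Measurable X :=
    (measurable_pi_lambda _ hD_meas).prodMk (measurable_pi_lambda _ hV_meas)
  have hT : Measurable fun ω => (S' ω, R' ω) := hS'_meas.prodMk hR'_meas
  let zip : (Fin n → (𝒮 × 𝒜) × ℝ) × (Fin n → ℝ) → Fin n → ((𝒮 × 𝒜) × ℝ) × ℝ :=
    (MeasurableEquiv.arrowProdEquivProdArrow ((𝒮 × 𝒜) × ℝ) ℝ (Fin n)).symm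
  have hZ : MeasurePreserving (fun ω => zip (X ω)) P
      (Measure.pi fun _ => sampleLaw PS PR πb) := by
    have hU : ∀ i, P.map (V i) = volume.restrict (Set.Icc (0 : ℝ) 1) := by
      intro i
      rw [hV_law i]
      simp [ProbabilityTheory.cond]
    have h1 : P.map X = (Measure.pi fun _ : Fin n => observationLaw PS PR πb).prod
        (Measure.pi fun _ : Fin n => volume.restrict (Set.Icc (0 : ℝ) 1)) := by
      rw [hXdef, (indepFun_iff_map_prod_eq_prod_map_map (by fun_prop) (by fun_prop)).1 hDV_indep,
        (iIndepFun_iff_map_fun_eq_pi_map fun i => (hD_meas i).aemeasurable).1 hD_indep,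
        (iIndepFun_iff_map_fun_eq_pi_map fun i => (hV_meas i).aemeasurable).1 hV_indep]
      simp_rw [hD_law, hU]
    have h2 := (measurePreserving_arrowProdEquivProdArrow ((𝒮 × 𝒜) × ℝ) ℝ (Fin n)
      (fun _ => observationLaw PS PR πb) (fun _ => volume.restrict (Set.Icc (0 : ℝ) 1))).symm
    exact h2.comp ⟨hX, h1⟩
  have hE : MeasurableSet {z : ((Fin n → (𝒮 × 𝒜) × ℝ) × (Fin n → ℝ)) × (𝒮 × ℝ) |
      z.2 ∈ missSet split Aqu εlo εup ε δ (rejectionSample πe πb z.1.1 z.1.2)} :=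
    measurableSet_rejectionSample πe πb n
      (Q := fun N y t => t ∈ missSet split Aqu εlo εup ε δ (N := N) y)
      (measurableSet_missSet split Aqu εlo εup ε hδ.1.le)
  -- The test pair is independent of the data, so conditioning amounts to freezing the data and
  -- measuring the missed pairs under P^{π_e}. The identity holds only almost surely, which suffices
  -- for the event below.
  have hL : L =ᵐ[P] fun ω =>
      μ.real (missSet split Aqu εlo εup ε δ (rejectionSample πe πb (X ω).1 (X ω).2)) := by
    have h := condExp_indicator_ae_eq_of_indepFun hX hT hT_indep.symm hE
    rw [hT_law] at h
    exact h
  have hS : MeasurableSet {x : Fin n → ((𝒮 × 𝒜) × ℝ) × ℝ |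
      μ.real (missSet split Aqu εlo εup ε δ
        (rejectionSample πe πb (fun i => (x i).1) (fun i => (x i).2))) ≤ ε} := by
    have hm := (measurable_measure_prodMk_left (ν := μ) hE).ennreal_toReal.comp
      (MeasurableEquiv.arrowProdEquivProdArrow ((𝒮 × 𝒜) × ℝ) ℝ (Fin n)).measurable
    exact measurableSet_le hm measurable_const
  have hI : MeasurableSet {x : Fin n → ((𝒮 × 𝒜) × ℝ) × ℝ |
      Function.Injective (calibrationScores split Aqu εlo εup
        (rejectionSample πe πb (fun i => (x i).1) (fun i => (x i).2)))} := by
    have hm := measurableSet_rejectionSample πe πb n (T := Unit)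
      (Q := fun N y _ => Function.Injective (calibrationScores split Aqu εlo εup (N := N) y))
      (fun N => measurable_fst (measurableSet_injective_calibrationScores split Aqu εlo εup N))
    exact ((MeasurableEquiv.arrowProdEquivProdArrow ((𝒮 × 𝒜) × ℝ) ℝ (Fin n)).measurable.prodMk
      (measurable_const (a := ()))) hm
  have hties' : ∀ᵐ x ∂(Measure.pi fun _ : Fin n => sampleLaw PS PR πb),
      Function.Injective (calibrationScores split Aqu εlo εup
        (rejectionSample πe πb (fun i => (x i).1) (fun i => (x i).2))) := by
    rw [← hZ.map_eq, ae_map_iff hZ.measurable.aemeasurable hI]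
    exact hties
  refine lt_of_eq_of_lt ?_ (measureReal_missSet_rejectionSample_lt PS PR split Aqu εlo εup hB
    hε hδ hγ hn hties')
  rw [measureReal_def, measureReal_def, ← hZ.measure_preimage hS.nullMeasurableSet]
  congr 1
  refine measure_congr ?_
  filter_upwards [hL] with ω hω
  refine propext ?_
  change L ω ≤ ε ↔ _
  rw [hω]
  rfl
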